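/- Two-coloured partitions. A two-coloured partition $p$ with $k$ upper and $l$ lower points ($k,l\ge 0$) consists of colours $\omega\in\{1,*\}^k$, $\omega'\in\{1,*\}^l$ of the upper and lower points and a partition of the set of the $k+l$ points into blocks; a through-block is a block that contains both upper and lower points. Fix $N\ge 1$ and write $[n]=\{1,\dots,n\}$. A labeling of the upper (lower) row by elements of $[N]$ is valid if upper (lower) points in the same block have the same label. Let $T_0\subseteq[N]^k$ and $T_0'\subseteq[N]^l$ be the sets of invalid labelings of the rows. Enumerate the $r=N^{tb(p)}$ labelings of the $tb(p)$ through-blocks by elements of $[N]$, and for $1\le i\le r$ let $T_i\subseteq[N]^k$ and $T_i'\subseteq[N]^l$ be the sets of valid labelings of the upper and the lower row whose values on the through-blocks are given by the $i$-th of them. Relations. For an $N\times N$ matrix $u=(u_{ij})$ let $R^{Gr}_p(u)$ be the relations (i) $\sum_{t\in T_i}u_{t_1\gamma_1}^{\omega_1}\cdots u_{t_k\gamma_k}^{\omega_k}=\sum_{t'\in T'_j}u_{\gamma'_1t'_1}^{\omega'_1}\cdots u_{\gamma'_lt'_l}^{\omega'_l}$ for $1\le i,j\le r$, $\gamma\in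 T_j$, $\gamma'\in T'_i$; (ii) $\sum_{t\in T_i}u_{t_1\gamma_1}^{\omega_1}\cdots u_{t_k\gamma_k}^{\omega_k}=0$ for $1\le i\le r$, $\gamma\in T_0$; (iii) $\sum_{t'\in T'_j}u_{\gamma'_1t'_1}^{\omega'_1}\cdots u_{\gamma'_lt'_l}^{\omega'_l}=0$ for $1\le j\le r$, $\gamma'\in T'_0$. For $1\le d\le N$ and an $N\times d$ matrix $x=(x_{ij})$ let $R^{Sp}_p(x)$ be the relations (i) $\sum_{t\in T_i}x_{t_1\gamma_1}^{\omega_1}\cdots x_{t_k\gamma_k}^{\omega_k}=\sum_{t'\in T'_i}x_{t'_1\gamma'_1}^{\omega'_1}\cdots x_{t'_l\gamma'_l}^{\omega'_l}$ for $1\le i,j\le r$, $\gamma\in T_j\cap[d]^k$, $\gamma'\in T'_j\cap[d]^l$; (ii) $\sum_{t\in T_i}x_{t_1\gamma_1}^{\omega_1}\cdots x_{t_k\gamma_k}^{\omega_k}=0$ for $1\le i\le r$, $\gamma\in T_0\cap[d]^k$; (iii) $\sum_{t'\in T'_i}x_{t'_1\gamma'_1}^{\omega'_1}\cdots x_{t'_l\gamma'_l}^{\omega'_l}=0$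 for $1\le i\le r$, $\gamma'\in T'_0\cap[d]^l$. Empty products are $1$. Theorem. Let $1\le d\le N$ be integers and let $\Pi$ be a set of two-coloured partitions that contains the four mixed-coloured pair partitions (two points in one block, both in the upper row or both in the lower row, with colours $1*$ or $*1$ from left to right). Let $C(G_N(\Pi))$ be the universal unital $C^*$-algebra generated by $u_{ij}$ ($1\le i,j\le N$) subject to $R^{Gr}_p(u)$ for all $p\in\Pi$, and let $C(X_{N,d}(\Pi))$ be the universal unital $C^*$-algebra generated by $x_{ij}$ ($1\le i\le N$, $1\le j\le d$) subject to $R^{Sp}_p(x)$ for all $p\in\Pi$ (both exist). Let $\otimes$ be the minimal tensor product. Then $G_N(\Pi)$ is a compact matrix quantum group: the $u_{ij}$ generate $C(G_N(\Pi))$, the matrices $(u_{ij})$ and $(u_{ij}^*)$ are invertible, and there is a unital $*$-homomorphism $\Delta\colon C(G_N(\Pi))\to C(G_N(\Pi))\otimes C(G_N(\Pi))$ with $\Delta(u_{ij})=\sum_{k=1}^N u_{ik}\otimes u_{kj}$. The $x_{ij}$ generate $C(X_{N,d}(\Pi))$, and $G_N(\Pi)$ acts on $X_{N,d}(\Pi)$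 from the left and from the right by matrix-vector actions: (i) there is exactly one unital $*$-homomorphism $\alpha\colon C(X_{N,d}(\Pi))\to C(G_N(\Pi))\otimes C(X_{N,d}(\Pi))$ with $\alpha(x_{ij})=\sum_{k=1}^N u_{ik}\otimes x_{kj}$ for all $1\le i\le N$, $1\le j\le d$; (ii) there is exactly one unital $*$-homomorphism $\beta\colon C(X_{N,d}(\Pi))\to C(G_N(\Pi))\otimes C(X_{N,d}(\Pi))$ with $\beta(x_{ij})=\sum_{k=1}^N u_{ki}\otimes x_{kj}$ for all $1\le i\le N$, $1\le j\le d$. -/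

import Mathlib

noncomputable section

open scoped TensorProduct

/-! ### C*-seminorms and their Hausdorff completions -/

/-- A C*-seminorm on a unital complex *-algebra: a submultiplicative seminorm with
`p (x* x) = p x ^ 2`. -/
structure CStarSeminorm (R : Type*) [Ring R] [StarRing R] [Algebra ℂ R] extends
    Seminorm ℂ R where
  mul_le' : ∀ x y : R, toFun (x * y) ≤ toFun x * toFun y
  star_mul_self' : ∀ x : R, toFun (star x * x) = toFun x ^ 2

namespace CStarSeminorm

variable {R : Type*} [Ring R] [StarRing R] [Algebra ℂ R]

instance : CoeFun (CStarSeminorm R) (fun _ => R → ℝ) := ⟨fun p => p.toSeminorm⟩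

variable (p : CStarSeminorm R)

theorem nonneg (x : R) : 0 ≤ p x := apply_nonneg p.toSeminorm x

theorem mul_le (x y : R) : p (x * y) ≤ p x * p y := p.mul_le' x y

theorem star_mul_self (x : R) : p (star x * x) = p x ^ 2 := p.star_mul_self' x

theorem le_star (x : R) : p x ≤ p (star x) := by
  rcases (p.nonneg x).eq_or_lt with h | h
  · rw [← h]; exact p.nonneg _
  · have h1 := p.star_mul_self x
    have h2 := p.mul_le (star x) x
    nlinarith

theorem star_eq (x : R) : p (star x) = p x :=
  le_antisymm (by simpa using p.le_star (star x)) (p.le_star x)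

theorem one_le : p 1 ≤ 1 := by
  have h := p.star_mul_self 1
  simp only [star_one, mul_one] at h
  nlinarith [p.nonneg 1]

/-- The algebra `R`, regarded as a seminormed algebra with the seminorm `p`. -/
@[nolint unusedArguments]
def Carrier (_ : CStarSeminorm R) : Type _ := R

instance : Ring p.Carrier := inferInstanceAs (Ring R)

instance : StarRing p.Carrier := inferInstanceAs (StarRing R)

instance : Algebra ℂ p.Carrier := inferInstanceAs (Algebra ℂ R)

instance [StarModule ℂ R] : StarModule ℂ p.Carrier := inferInstanceAs (StarModule ℂ R)

instance : SeminormedRing p.Carrier :=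
  { (inferInstance : Ring p.Carrier),
    p.toSeminorm.toAddGroupSeminorm.toSeminormedAddCommGroup with
    norm_mul_le := p.mul_le' }

theorem norm_carrier (x : p.Carrier) : ‖x‖ = p x := rfl

instance : NormedAlgebra ℂ p.Carrier where
  norm_smul_le c x := (map_smul_eq_mul p.toSeminorm c x).le

instance : NormedStarGroup p.Carrier where
  norm_star_le x := (p.star_eq x).le

/-- The C*-algebra obtained from `R` by dividing out the null space of `p` and completing. -/
def Completion : Type _ := UniformSpace.Completion p.Carrier

instance : NormedRing p.Completion :=
  inferInstanceAs (NormedRing (UniformSpace.Completion p.Carrier))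

instance : CompleteSpace p.Completion :=
  inferInstanceAs (CompleteSpace (UniformSpace.Completion p.Carrier))

instance : Algebra ℂ p.Completion :=
  inferInstanceAs (Algebra ℂ (UniformSpace.Completion p.Carrier))

instance : NormedSpace ℂ p.Completion :=
  inferInstanceAs (NormedSpace ℂ (UniformSpace.Completion p.Carrier))

instance : NormedAlgebra ℂ p.Completion where
  norm_smul_le c x := norm_smul_le (β := UniformSpace.Completion p.Carrier) c x

/-- The canonical map from `R` to the completion. -/
def incl (x : R) : p.Completion := ((show p.Carrier from x : p.Carrier) :
  UniformSpace.Completion p.Carrier)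

theorem norm_incl (x : R) : ‖p.incl x‖ = p x :=
  UniformSpace.Completion.norm_coe (E := p.Carrier) x

theorem denseRange_incl : DenseRange p.incl :=
  UniformSpace.Completion.denseRange_coe (α := p.Carrier)

theorem incl_mul (x y : R) : p.incl (x * y) = p.incl x * p.incl y :=
  UniformSpace.Completion.coe_mul (α := p.Carrier) x y

theorem incl_add (x y : R) : p.incl (x + y) = p.incl x + p.incl y :=
  UniformSpace.Completion.coe_add (α := p.Carrier) x y

theorem incl_one : p.incl 1 = 1 := rfl

theorem incl_zero : p.incl 0 = 0 := rfl

theorem incl_algebraMap (c : ℂ) : p.incl (algebraMap ℂ R c) = algebraMap ℂ p.Completion c := rfl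

instance : Star p.Completion where
  star := UniformSpace.Completion.map (star : p.Carrier → p.Carrier)

theorem continuous_star_completion : Continuous (star : p.Completion → p.Completion) :=
  UniformSpace.Completion.continuous_map

theorem incl_star (x : R) : p.incl (star x) = star (p.incl x) :=
  (UniformSpace.Completion.map_coe (f := (star : p.Carrier → p.Carrier))
    star_isometry.uniformContinuous x).symm

instance : StarRing p.Completion where
  star_involutive x := by
    refine p.denseRange_incl.induction_on x (isClosed_eq
      (p.continuous_star_completion.comp p.continuous_star_completion) continuous_id) fun a => ?_
    rw [← incl_star, ← incl_star, star_star]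
  star_mul x y := by
    refine p.denseRange_incl.induction_on₂ (p := fun x y => star (x * y) = star y * star x)
      (isClosed_eq (p.continuous_star_completion.comp continuous_mul)
        ((p.continuous_star_completion.comp continuous_snd).mul
          (p.continuous_star_completion.comp continuous_fst))) (fun a b => ?_) x y
    rw [← incl_mul, ← incl_star, ← incl_star, ← incl_star, ← incl_mul, star_mul]
  star_add x y := by
    refine p.denseRange_incl.induction_on₂ (p := fun x y => star (x + y) = star x + star y)
      (isClosed_eq (p.continuous_star_completion.comp continuous_add)
        ((p.continuous_star_completion.comp continuous_fst).add
          (p.continuous_star_completion.comp continuous_snd))) (fun a b => ?_) x y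
    rw [← incl_add, ← incl_star, ← incl_star, ← incl_star, ← incl_add, star_add]

instance : CStarRing p.Completion where
  norm_mul_self_le x := by
    refine p.denseRange_incl.induction_on x (isClosed_le (by fun_prop)
      ((p.continuous_star_completion.mul continuous_id).norm)) fun a => ?_
    rw [← incl_star, ← incl_mul, norm_incl, norm_incl, star_mul_self, sq]

instance [StarModule ℂ R] : StarModule ℂ p.Completion where
  star_smul c x := by
    refine p.denseRange_incl.induction_on x (isClosed_eq
      (p.continuous_star_completion.comp (continuous_const_smul c))
      ((continuous_const_smul (star c)).comp p.continuous_star_completion)) fun a => ?_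
    rw [Algebra.smul_def, Algebra.smul_def, ← incl_algebraMap, ← incl_algebraMap, ← incl_mul,
      ← incl_star, ← incl_star, ← incl_mul, ← Algebra.smul_def, ← Algebra.smul_def, star_smul]

instance [StarModule ℂ R] : CStarAlgebra p.Completion where

/-- The canonical unital *-homomorphism from `R` to the completion. -/
def inclHom : R →⋆ₐ[ℂ] p.Completion where
  toFun := p.incl
  map_one' := p.incl_one
  map_mul' := p.incl_mul
  map_zero' := p.incl_zero
  map_add' := p.incl_add
  commutes' := p.incl_algebraMap
  map_star' := p.incl_star

/-- The pointwise supremum of a pointwise bounded set of C*-seminorms. -/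
def sup (S : Set (CStarSeminorm R)) (hS : ∀ x, BddAbove (Set.range fun p : S => p.1 x)) :
    CStarSeminorm R where
  toFun x := ⨆ p : S, p.1 x
  map_zero' := by simp
  add_le' x y := Real.iSup_le (fun p => (map_add_le_add p.1.toSeminorm x y).trans
      (add_le_add (le_ciSup (hS x) p) (le_ciSup (hS y) p)))
    (add_nonneg (Real.iSup_nonneg fun p => p.1.nonneg x) (Real.iSup_nonneg fun p => p.1.nonneg y))
  neg' x := by simp
  smul' c x := by
    simp only [map_smul_eq_mul]
    rw [Real.mul_iSup_of_nonneg (norm_nonneg c)]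
  mul_le' x y := Real.iSup_le (fun p => (p.1.mul_le x y).trans
      (mul_le_mul (le_ciSup (hS x) p) (le_ciSup (hS y) p) (p.1.nonneg y)
        (Real.iSup_nonneg fun p => p.1.nonneg x)))
    (mul_nonneg (Real.iSup_nonneg fun p => p.1.nonneg x) (Real.iSup_nonneg fun p => p.1.nonneg y))
  star_mul_self' x := by
    apply le_antisymm
    · refine Real.iSup_le (fun p => ?_) (sq_nonneg _)
      rw [p.1.star_mul_self]
      exact pow_le_pow_left₀ (p.1.nonneg x) (le_ciSup (hS x) p) 2
    · have h0 : 0 ≤ ⨆ p : S, p.1 (star x * x) := Real.iSup_nonneg fun p => p.1.nonneg _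
      refine (Real.le_sqrt (Real.iSup_nonneg fun p => p.1.nonneg x) h0).1
        (Real.iSup_le (fun p => Real.le_sqrt_of_sq_le ?_) (Real.sqrt_nonneg _))
      rw [← p.1.star_mul_self]
      exact le_ciSup (hS (star x * x)) p

end CStarSeminorm

/-! ### Universal C*-algebras -/

/-- The two colours of points, white (exponent `1`) and black (exponent `*`). -/
inductive Colour
  | white
  | black

namespace Colour

/-- The other colour. -/
def flip : Colour → Colour
  | white => black
  | black => white

@[simp] theorem flip_flip (c : Colour) : c.flip.flip = c := by cases c <;> rfl

/-- The power `a ^ c`: it is `a` for the exponent `1` and `a*` for the exponent `*`. -/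
def pow {A : Type*} [Star A] (c : Colour) (a : A) : A :=
  match c with
  | white => a
  | black => star a

end Colour

/-- The free unital complex *-algebra on `E` (*-polynomials in noncommuting variables): finite
linear combinations of words in the letters `e = (e, white)` and `e* = (e, black)`. -/
def FreeStarAlgebra (E : Type*) : Type _ := MonoidAlgebra ℂ (FreeMonoid (E × Colour))

namespace FreeStarAlgebra

variable {E : Type*}

instance : Ring (FreeStarAlgebra E) :=
  inferInstanceAs (Ring (MonoidAlgebra ℂ (FreeMonoid (E × Colour))))

instance : Algebra ℂ (FreeStarAlgebra E) :=
  inferInstanceAs (Algebra ℂ (MonoidAlgebra ℂ (FreeMonoid (E × Colour))))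

/-- The scalar multiple `c w` of a word `w`. -/
def term (w : FreeMonoid (E × Colour)) (c : ℂ) : FreeStarAlgebra E := MonoidAlgebra.single w c

theorem term_mul (w v : FreeMonoid (E × Colour)) (a b : ℂ) :
    term w a * term v b = term (w * v) (a * b) := MonoidAlgebra.single_mul_single _ _ _ _

theorem smul_term (w : FreeMonoid (E × Colour)) (a b : ℂ) :
    a • term w b = term w (a * b) := MonoidAlgebra.smul_single _ _ _

theorem one_def : (1 : FreeStarAlgebra E) = term 1 1 := rfl

@[elab_as_elim]
theorem induction {motive : FreeStarAlgebra E → Prop} (f : FreeStarAlgebra E)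
    (zero : motive 0) (add : ∀ f g, motive f → motive g → motive (f + g))
    (term : ∀ w c, motive (term w c)) : motive f :=
  MonoidAlgebra.induction_linear f zero add term

/-- The adjoint of a word: reverse it and exchange `e` and `e*`. -/
def wordStar (w : FreeMonoid (E × Colour)) : FreeMonoid (E × Colour) :=
  FreeMonoid.ofList ((w.toList.map fun a => (a.1, a.2.flip)).reverse)

theorem wordStar_mul (w v : FreeMonoid (E × Colour)) :
    wordStar (w * v) = wordStar v * wordStar w := by
  simp [wordStar, FreeMonoid.toList_mul, FreeMonoid.ofList_append]

theorem wordStar_wordStar (w : FreeMonoid (E × Colour)) : wordStar (wordStar w) = w := by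
  simp [wordStar, Function.comp_def]

/-- The involution as an additive map. -/
def starHom : FreeStarAlgebra E →+ FreeStarAlgebra E :=
  (Finsupp.liftAddHom fun w : FreeMonoid (E × Colour) =>
    ({ toFun := fun c => term (wordStar w) (star c)
       map_zero' := by rw [star_zero]; exact MonoidAlgebra.single_zero _
       map_add' := fun a b => by
        rw [star_add]; exact MonoidAlgebra.single_add _ _ _ } : ℂ →+ FreeStarAlgebra E)).comp
    MonoidAlgebra.coeffAddEquiv.toAddMonoidHom

theorem starHom_term (w : FreeMonoid (E × Colour)) (c : ℂ) :
    starHom (term w c) = term (wordStar w) (star c) :=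
  Finsupp.liftAddHom_apply_single _ w c

instance : StarRing (FreeStarAlgebra E) where
  star := starHom
  star_involutive f := by
    induction f using FreeStarAlgebra.induction with
    | zero => simp
    | add f g hf hg => rw [map_add, map_add, hf, hg]
    | term w c => rw [starHom_term, starHom_term, wordStar_wordStar, star_star]
  star_add := map_add starHom
  star_mul f g := by
    change starHom (f * g) = starHom g * starHom f
    induction f using FreeStarAlgebra.induction with
    | zero => simp
    | add f₁ f₂ h₁ h₂ => rw [add_mul, map_add, map_add, h₁, h₂, mul_add]
    | term w c =>
      induction g using FreeStarAlgebra.induction with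
      | zero => simp
      | add g₁ g₂ h₁ h₂ => rw [mul_add, map_add, map_add, h₁, h₂, add_mul]
      | term v b =>
        rw [term_mul, starHom_term, starHom_term, starHom_term, term_mul, wordStar_mul, star_mul]

theorem star_term (w : FreeMonoid (E × Colour)) (c : ℂ) :
    star (term w c) = term (wordStar w) (star c) := starHom_term w c

instance : StarModule ℂ (FreeStarAlgebra E) where
  star_smul a f := by
    induction f using FreeStarAlgebra.induction with
    | zero => simp
    | add f g hf hg => rw [smul_add, star_add, hf, hg, star_add, smul_add]
    | term w c => rw [smul_term, star_term, star_term, smul_term, star_mul, mul_comm]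

/-- The free generator belonging to `e`. -/
def gen (e : E) : FreeStarAlgebra E := term (FreeMonoid.of (e, Colour.white)) 1

theorem term_of (e : E) (c : Colour) : term (FreeMonoid.of (e, c)) 1 = c.pow (gen e) := by
  cases c
  · rfl
  · change _ = star (gen e)
    rw [gen, star_term, star_one]
    rfl

end FreeStarAlgebra

/-- The C*-seminorms on the free *-algebra in which every element of `R` becomes zero. -/
def relationSeminorms {E : Type*} (R : Set (FreeStarAlgebra E)) :
    Set (CStarSeminorm (FreeStarAlgebra E)) :=
  {p | ∀ r ∈ R, p r = 0}

/-- The condition under which the universal C*-algebra exists: for every *-polynomial `f`, the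
values `p f` of the C*-seminorms which respect the relations are bounded. -/
def UniversalExists {E : Type*} (R : Set (FreeStarAlgebra E)) : Prop :=
  ∀ f, BddAbove (Set.range fun p : relationSeminorms R => p.1 f)

theorem universalExists_of_gen_le_one {E : Type*} (R : Set (FreeStarAlgebra E))
    (h : ∀ p ∈ relationSeminorms R, ∀ e, p (FreeStarAlgebra.gen e) ≤ 1) : UniversalExists R := by
  have key : ∀ p ∈ relationSeminorms R, ∀ w : FreeMonoid (E × Colour),
      p (FreeStarAlgebra.term w 1) ≤ 1 := by
    intro p hp w
    induction w using FreeMonoid.inductionOn' with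
    | one => exact p.one_le
    | of_mul a w ih =>
      have hmul : FreeStarAlgebra.term (FreeMonoid.of a * w) 1 =
          FreeStarAlgebra.term (FreeMonoid.of a) 1 * FreeStarAlgebra.term w 1 := by
        rw [FreeStarAlgebra.term_mul, one_mul]
      rw [hmul]
      refine (p.mul_le _ _).trans (mul_le_one₀ ?_ (p.nonneg _) ih)
      obtain ⟨e, c⟩ := a
      rw [FreeStarAlgebra.term_of]
      cases c
      · exact h p hp e
      · exact (p.star_eq _).trans_le (h p hp e)
  intro f
  induction f using FreeStarAlgebra.induction with
  | zero =>
    refine ⟨0, ?_⟩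
    rintro _ ⟨p, rfl⟩
    exact (map_zero p.1.toSeminorm).le
  | add f g hf hg =>
    obtain ⟨a, ha⟩ := hf
    obtain ⟨b, hb⟩ := hg
    refine ⟨a + b, ?_⟩
    rintro _ ⟨p, rfl⟩
    exact (map_add_le_add p.1.toSeminorm f g).trans (add_le_add (ha ⟨p, rfl⟩) (hb ⟨p, rfl⟩))
  | term w c =>
    refine ⟨‖c‖, ?_⟩
    rintro _ ⟨p, rfl⟩
    have hc : FreeStarAlgebra.term w c = c • FreeStarAlgebra.term w 1 := by
      rw [FreeStarAlgebra.smul_term, mul_one]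
    change p.1.toSeminorm _ ≤ _
    rw [hc, map_smul_eq_mul]
    exact mul_le_of_le_one_right (norm_nonneg c) (key p.1 p.2 w)

/-- The universal unital C*-algebra `C*(E | R)` generated by `E` subject to the relations `r = 0`
for `r ∈ R`: the completion of the free *-algebra with respect to the largest C*-seminorm that
respects the relations. -/
abbrev UniversalCStarAlgebra {E : Type*} (R : Set (FreeStarAlgebra E)) (hR : UniversalExists R) :
    Type _ :=
  (CStarSeminorm.sup (relationSeminorms R) hR).Completion

/-- The generator of `C*(E | R)` belonging to `e`. -/
def UniversalCStarAlgebra.gen {E : Type*} (R : Set (FreeStarAlgebra E)) (hR : UniversalExists R)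
    (e : E) : UniversalCStarAlgebra R hR :=
  (CStarSeminorm.sup (relationSeminorms R) hR).inclHom (FreeStarAlgebra.gen e)

/-! ### The minimal tensor product of unital C*-algebras -/

section MinTensor

universe u v

variable {A : Type u} {B : Type v} [CStarAlgebra A] [CStarAlgebra B]

section Representations

variable {H : Type u} {K : Type v} [NormedAddCommGroup H] [InnerProductSpace ℂ H] [CompleteSpace H]
  [NormedAddCommGroup K] [InnerProductSpace ℂ K] [CompleteSpace K]

/-- `a ↦ π a ⊗ 1`, by bounded operators on the algebraic tensor product `H ⊗ K` with its
inner product. -/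
def leftRep (K : Type v) [NormedAddCommGroup K] [InnerProductSpace ℂ K]
    (π : A →⋆ₐ[ℂ] (H →L[ℂ] H)) : A →ₐ[ℂ] ((H ⊗[ℂ] K) →L[ℂ] (H ⊗[ℂ] K)) :=
  AlgHom.ofLinearMap
    { toFun := fun a => (π a).rTensor K
      map_add' := fun a b => by rw [map_add, ContinuousLinearMap.rTensor_add]
      map_smul' := fun c a => by rw [map_smul, ContinuousLinearMap.rTensor_smul]; rfl }
    (by simp) (fun a b => by simp [ContinuousLinearMap.rTensor_mul])

/-- `b ↦ 1 ⊗ ρ b`, by bounded operators on the algebraic tensor product `H ⊗ K` with its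
inner product. -/
def rightRep (H : Type u) [NormedAddCommGroup H] [InnerProductSpace ℂ H]
    (ρ : B →⋆ₐ[ℂ] (K →L[ℂ] K)) : B →ₐ[ℂ] ((H ⊗[ℂ] K) →L[ℂ] (H ⊗[ℂ] K)) :=
  AlgHom.ofLinearMap
    { toFun := fun b => (ρ b).lTensor H
      map_add' := fun a b => by rw [map_add, ContinuousLinearMap.lTensor_add]
      map_smul' := fun c a => by rw [map_smul, ContinuousLinearMap.lTensor_smul]; rfl }
    (by simp) (fun a b => by simp [ContinuousLinearMap.lTensor_mul])

/-- The representation `π ⊗ ρ` of the algebraic tensor product, `a ⊗ b ↦ π a ⊗ ρ b`. The operators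
are given on the dense subspace `H ⊗ K` (algebraic) of the Hilbert space tensor product; restricting
a bounded operator to a dense subspace does not change its operator norm. -/
def tensorRep (π : A →⋆ₐ[ℂ] (H →L[ℂ] H)) (ρ : B →⋆ₐ[ℂ] (K →L[ℂ] K)) :
    A ⊗[ℂ] B →ₐ[ℂ] ((H ⊗[ℂ] K) →L[ℂ] (H ⊗[ℂ] K)) :=
  Algebra.TensorProduct.lift (leftRep K π) (rightRep H ρ) fun a b => by
    change (π a).rTensor K ∘L (ρ b).lTensor H = (ρ b).lTensor H ∘L (π a).rTensor K
    ext x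
    induction x with
    | zero => simp
    | add x y hx hy => rw [map_add, map_add, hx, hy]
    | tmul x y => simp

theorem tensorRep_tmul (π : A →⋆ₐ[ℂ] (H →L[ℂ] H)) (ρ : B →⋆ₐ[ℂ] (K →L[ℂ] K)) (a : A) (b : B)
    (x : H) (y : K) : tensorRep π ρ (a ⊗ₜ b) (x ⊗ₜ y) = π a x ⊗ₜ ρ b y := by
  rw [tensorRep, Algebra.TensorProduct.lift_tmul]
  rfl

theorem inner_tensorRep (π : A →⋆ₐ[ℂ] (H →L[ℂ] H)) (ρ : B →⋆ₐ[ℂ] (K →L[ℂ] K)) (z : A ⊗[ℂ] B)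
    (ξ η : H ⊗[ℂ] K) :
    inner ℂ (tensorRep π ρ z ξ) η = inner ℂ ξ (tensorRep π ρ (star z) η) := by
  induction z with
  | zero => simp
  | add z w hz hw =>
    rw [map_add, star_add, map_add, add_apply, add_apply,
      inner_add_left, inner_add_right, hz, hw]
  | tmul a b =>
    induction ξ with
    | zero => simp
    | add ξ ξ' h h' => rw [map_add, inner_add_left, inner_add_left, h, h']
    | tmul x y =>
      induction η with
      | zero => simp
      | add η η' h h' => rw [map_add, inner_add_right, inner_add_right, h, h']
      | tmul x' y' =>
        rw [TensorProduct.star_tmul, tensorRep_tmul, tensorRep_tmul, TensorProduct.inner_tmul,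
          TensorProduct.inner_tmul, map_star, map_star, ContinuousLinearMap.star_eq_adjoint,
          ContinuousLinearMap.star_eq_adjoint, ContinuousLinearMap.adjoint_inner_right,
          ContinuousLinearMap.adjoint_inner_right]

theorem opNorm_smul_eq {V : Type*} [NormedAddCommGroup V] [InnerProductSpace ℂ V] (c : ℂ)
    (T : V →L[ℂ] V) : ‖c • T‖ = ‖c‖ * ‖T‖ := norm_smul c T

/-- The C*-seminorm `z ↦ ‖(π ⊗ ρ) z‖` on the algebraic tensor product. -/
def spatialSeminorm (π : A →⋆ₐ[ℂ] (H →L[ℂ] H)) (ρ : B →⋆ₐ[ℂ] (K →L[ℂ] K)) :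
    CStarSeminorm (A ⊗[ℂ] B) where
  toFun z := ‖tensorRep π ρ z‖
  map_zero' := by rw [map_zero]; exact ContinuousLinearMap.opNorm_zero
  add_le' z w := by
    rw [map_add]; exact ContinuousLinearMap.opNorm_add_le (tensorRep π ρ z) (tensorRep π ρ w)
  neg' z := by rw [map_neg]; exact ContinuousLinearMap.opNorm_neg (tensorRep π ρ z)
  smul' c z := by rw [map_smul]; exact opNorm_smul_eq c (tensorRep π ρ z)
  mul_le' z w := by rw [map_mul]; exact norm_mul_le (tensorRep π ρ z) (tensorRep π ρ w)
  star_mul_self' z := by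
    have main : ∀ z : A ⊗[ℂ] B, ‖tensorRep π ρ z‖ ^ 2 ≤ ‖tensorRep π ρ (star z * z)‖ := by
      intro z
      have h0 : 0 ≤ ‖tensorRep π ρ (star z * z)‖ := ContinuousLinearMap.opNorm_nonneg _
      refine (Real.le_sqrt (ContinuousLinearMap.opNorm_nonneg _) h0).1
        (ContinuousLinearMap.opNorm_le_bound _ (Real.sqrt_nonneg _) fun ξ => ?_)
      refine (sq_le_sq₀ (norm_nonneg _) (by positivity)).1 ?_
      rw [mul_pow, Real.sq_sqrt h0, ← inner_self_eq_norm_sq (𝕜 := ℂ), inner_tensorRep]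
      refine (RCLike.re_le_norm _).trans ((norm_inner_le_norm (𝕜 := ℂ) ξ
        (tensorRep π ρ (star z) (tensorRep π ρ z ξ))).trans ?_)
      rw [← mul_apply_eq_comp, ← map_mul]
      have h := (tensorRep π ρ (star z * z)).le_opNorm ξ
      nlinarith [norm_nonneg ξ]
    have hs : ∀ z : A ⊗[ℂ] B, ‖tensorRep π ρ z‖ ≤ ‖tensorRep π ρ (star z)‖ := by
      intro z
      rcases (ContinuousLinearMap.opNorm_nonneg (tensorRep π ρ z)).eq_or_lt with h | h
      · rw [← h]; exact ContinuousLinearMap.opNorm_nonneg _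
      · have h1 := main z
        rw [map_mul] at h1
        have h2 := norm_mul_le (tensorRep π ρ (star z)) (tensorRep π ρ z)
        nlinarith
    refine le_antisymm ?_ (main z)
    have h3 := hs (star z)
    rw [star_star] at h3
    rw [map_mul, sq]
    exact (norm_mul_le (tensorRep π ρ (star z)) (tensorRep π ρ z)).trans
      (mul_le_mul_of_nonneg_right h3 (ContinuousLinearMap.opNorm_nonneg _))

theorem spatialSeminorm_apply (π : A →⋆ₐ[ℂ] (H →L[ℂ] H)) (ρ : B →⋆ₐ[ℂ] (K →L[ℂ] K))
    (z : A ⊗[ℂ] B) : spatialSeminorm π ρ z = ‖tensorRep π ρ z‖ := rfl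

end Representations

variable (A B)

/-- All the seminorms `z ↦ ‖(π ⊗ ρ) z‖`, for *-representations `π` of `A` and `ρ` of `B` on Hilbert
spaces. -/
def spatialSeminorms : Set (CStarSeminorm (A ⊗[ℂ] B)) :=
  {p | ∃ (H : Type u) (_ : NormedAddCommGroup H) (_ : InnerProductSpace ℂ H) (_ : CompleteSpace H)
    (K : Type v) (_ : NormedAddCommGroup K) (_ : InnerProductSpace ℂ K) (_ : CompleteSpace K)
    (π : A →⋆ₐ[ℂ] (H →L[ℂ] H)) (ρ : B →⋆ₐ[ℂ] (K →L[ℂ] K)), p = spatialSeminorm π ρ}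

theorem bddAbove_spatialSeminorms (z : A ⊗[ℂ] B) :
    BddAbove (Set.range fun p : spatialSeminorms A B => p.1 z) := by
  induction z with
  | zero =>
    refine ⟨0, ?_⟩
    rintro _ ⟨p, rfl⟩
    exact (map_zero p.1.toSeminorm).le
  | add z w hz hw =>
    obtain ⟨a, ha⟩ := hz
    obtain ⟨b, hb⟩ := hw
    refine ⟨a + b, ?_⟩
    rintro _ ⟨p, rfl⟩
    exact (map_add_le_add p.1.toSeminorm z w).trans (add_le_add (ha ⟨p, rfl⟩) (hb ⟨p, rfl⟩))
  | tmul a b =>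
    refine ⟨‖a‖ * ‖b‖, ?_⟩
    rintro _ ⟨⟨p, H, _, _, _, K, _, _, _, π, ρ, rfl⟩, rfl⟩
    change spatialSeminorm π ρ (a ⊗ₜ b) ≤ _
    rw [spatialSeminorm_apply, tensorRep, Algebra.TensorProduct.lift_tmul]
    refine (norm_mul_le (leftRep K π a) (rightRep H ρ b)).trans
      (mul_le_mul ?_ ?_ (ContinuousLinearMap.opNorm_nonneg _) (norm_nonneg _))
    · exact ((π a).norm_rTensor_le (G := K)).trans (NonUnitalStarAlgHom.norm_apply_le π a)
    · exact ((ρ b).norm_lTensor_le (G := H)).trans (NonUnitalStarAlgHom.norm_apply_le ρ b)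

/-- The minimal (spatial) tensor product of two unital C*-algebras. -/
abbrev MinTensor : Type (max u v) :=
  (CStarSeminorm.sup (spatialSeminorms A B) (bddAbove_spatialSeminorms A B)).Completion

variable {A B}

/-- The elementary tensor `a ⊗ b` in the minimal tensor product. -/
def MinTensor.tmul (a : A) (b : B) : MinTensor A B :=
  (CStarSeminorm.sup (spatialSeminorms A B) (bddAbove_spatialSeminorms A B)).inclHom (a ⊗ₜ b)

end MinTensor

/-! ### Two-coloured partitions and their labelings -/

/-- A two-coloured partition on `k` upper and `l` lower points: a colour for every point and a
partition of the set of all points into blocks (the classes of an equivalence relation). -/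
structure TwoColouredPartition where
  /-- The number of upper points. -/
  k : ℕ
  /-- The number of lower points. -/
  l : ℕ
  /-- The colours of the upper points, from left to right. -/
  upperColour : Fin k → Colour
  /-- The colours of the lower points, from left to right. -/
  lowerColour : Fin l → Colour
  /-- The relation "in the same block" on the upper (`inl`) and lower (`inr`) points. -/
  blocks : Setoid (Fin k ⊕ Fin l)

namespace TwoColouredPartition

/-- The pair partition without upper points, whose two lower points have the given colours. -/
def lowerPair (c₁ c₂ : Colour) : TwoColouredPartition where
  k := 0
  l := 2
  upperColour := ![]
  lowerColour := ![c₁, c₂]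
  blocks := ⊤

/-- The pair partition without lower points, whose two upper points have the given colours. -/
def upperPair (c₁ c₂ : Colour) : TwoColouredPartition where
  k := 2
  l := 0
  upperColour := ![c₁, c₂]
  lowerColour := ![]
  blocks := ⊤

/-- The four mixed-coloured pair partitions. -/
def mixedPairs : Set TwoColouredPartition :=
  {lowerPair .white .black, lowerPair .black .white,
    upperPair .white .black, upperPair .black .white}

variable (p : TwoColouredPartition)

/-- The through-blocks: the blocks that contain both upper and lower points. -/
def ThroughBlock : Type :=
  {b : Quotient p.blocks //
    (∃ a : Fin p.k, Quotient.mk p.blocks (Sum.inl a) = b) ∧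
      ∃ a : Fin p.l, Quotient.mk p.blocks (Sum.inr a) = b}

variable {N d : ℕ}

/-- A labeling of the upper row is valid if upper points in the same block have equal labels. -/
def UpperValid (t : Fin p.k → Fin N) : Prop :=
  ∀ a b : Fin p.k, p.blocks (Sum.inl a) (Sum.inl b) → t a = t b

/-- A labeling of the lower row is valid if lower points in the same block have equal labels. -/
def LowerValid (t : Fin p.l → Fin N) : Prop :=
  ∀ a b : Fin p.l, p.blocks (Sum.inr a) (Sum.inr b) → t a = t b

/-- The set `T_0` of the invalid labelings of the upper row. -/
def upperInvalid (N : ℕ) : Set (Fin p.k → Fin N) := {t | ¬ p.UpperValid t}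

/-- The set `T'_0` of the invalid labelings of the lower row. -/
def lowerInvalid (N : ℕ) : Set (Fin p.l → Fin N) := {t | ¬ p.LowerValid t}

/-- The set `T_i` of the valid labelings of the upper row with the through-block labeling `i`. The
index `i` runs through the `r = N ^ tb(p)` labelings of the through-blocks. -/
def upperClass (i : p.ThroughBlock → Fin N) : Set (Fin p.k → Fin N) :=
  {t | p.UpperValid t ∧ ∀ (a : Fin p.k) (b : p.ThroughBlock),
    Quotient.mk p.blocks (Sum.inl a) = b.1 → t a = i b}

/-- The set `T'_i` of the valid labelings of the lower row with the through-block labeling `i`. -/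
def lowerClass (i : p.ThroughBlock → Fin N) : Set (Fin p.l → Fin N) :=
  {t | p.LowerValid t ∧ ∀ (a : Fin p.l) (b : p.ThroughBlock),
    Quotient.mk p.blocks (Sum.inr a) = b.1 → t a = i b}

variable {A : Type*} [Ring A] [StarRing A]

open scoped Classical in
/-- The sum of the products `x_{t_1 γ_1}^{ω_1} ⋯ x_{t_k γ_k}^{ω_k}` over `t ∈ T_i`. -/
def upperSum (x : Matrix (Fin N) (Fin d) A) (i : p.ThroughBlock → Fin N) (γ : Fin p.k → Fin d) :
    A :=
  ∑ t : Fin p.k → Fin N with t ∈ p.upperClass i,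
    (List.ofFn fun a => (p.upperColour a).pow (x (t a) (γ a))).prod

open scoped Classical in
/-- The sum of the products `x_{t'_1 γ'_1}^{ω'_1} ⋯ x_{t'_l γ'_l}^{ω'_l}` over `t' ∈ T'_i`. -/
def lowerSum (x : Matrix (Fin N) (Fin d) A) (i : p.ThroughBlock → Fin N) (γ : Fin p.l → Fin d) :
    A :=
  ∑ t : Fin p.l → Fin N with t ∈ p.lowerClass i,
    (List.ofFn fun a => (p.lowerColour a).pow (x (t a) (γ a))).prod

/-- The quantum group relations `R^{Gr}_p(u)`, as the set of the elements that they set to zero.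
Note that `lowerSum uᵀ j γ'` is the sum of `u_{γ'_1 t'_1}^{ω'_1} ⋯ u_{γ'_l t'_l}^{ω'_l}` over
`t' ∈ T'_j`. -/
def groupRelations (u : Matrix (Fin N) (Fin N) A) : Set A :=
  {r | ∃ i j : p.ThroughBlock → Fin N, ∃ γ ∈ p.upperClass j, ∃ γ' ∈ p.lowerClass i,
      r = p.upperSum u i γ - p.lowerSum u.transpose j γ'} ∪
  {r | ∃ i : p.ThroughBlock → Fin N, ∃ γ ∈ p.upperInvalid N, r = p.upperSum u i γ} ∪
  {r | ∃ j : p.ThroughBlock → Fin N, ∃ γ' ∈ p.lowerInvalid N, r = p.lowerSum u.transpose j γ'}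

/-- The quantum space relations `R^{Sp}_p(x)` for `d ≤ N` vectors of length `N` (the columns of
`x`), as the set of the elements that they set to zero. Labelings with values in `[d]` are regarded
as labelings with values in `[N]`. -/
def spaceRelations (hd : d ≤ N) (x : Matrix (Fin N) (Fin d) A) : Set A :=
  {r | ∃ i j : p.ThroughBlock → Fin N, ∃ (γ : Fin p.k → Fin d) (γ' : Fin p.l → Fin d),
      Fin.castLE hd ∘ γ ∈ p.upperClass j ∧ Fin.castLE hd ∘ γ' ∈ p.lowerClass j ∧
      r = p.upperSum x i γ - p.lowerSum x i γ'} ∪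
  {r | ∃ (i : p.ThroughBlock → Fin N) (γ : Fin p.k → Fin d),
      Fin.castLE hd ∘ γ ∈ p.upperInvalid N ∧ r = p.upperSum x i γ} ∪
  {r | ∃ (i : p.ThroughBlock → Fin N) (γ' : Fin p.l → Fin d),
      Fin.castLE hd ∘ γ' ∈ p.lowerInvalid N ∧ r = p.lowerSum x i γ'}

/-! The relations of one mixed-coloured pair partition bound the generators. -/

instance (c₁ c₂ : Colour) : IsEmpty (lowerPair c₁ c₂).ThroughBlock :=
  ⟨fun b => Fin.elim0 b.2.1.choose⟩

theorem const_mem_lowerClass (i : p.ThroughBlock → Fin N) (j : Fin N) [IsEmpty p.ThroughBlock] :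
    (fun _ => j) ∈ p.lowerClass i :=
  ⟨fun _ _ _ => rfl, fun _ b => isEmptyElim b⟩

theorem mem_upperClass_lowerPair {c₁ c₂ : Colour} (i : (lowerPair c₁ c₂).ThroughBlock → Fin N)
    (t : Fin (lowerPair c₁ c₂).k → Fin N) : t ∈ (lowerPair c₁ c₂).upperClass i :=
  ⟨fun a => Fin.elim0 a, fun a => Fin.elim0 a⟩

theorem upperSum_lowerPair {c₁ c₂ : Colour} (x : Matrix (Fin N) (Fin d) A)
    (i : (lowerPair c₁ c₂).ThroughBlock → Fin N) (γ : Fin (lowerPair c₁ c₂).k → Fin d) :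
    (lowerPair c₁ c₂).upperSum x i γ = 1 := by
  classical
  unfold upperSum
  refine (Finset.sum_eq_single (fun a => Fin.elim0 a) (fun t _ ht => ?_) fun h => ?_).trans ?_
  · exact absurd (funext fun a => Fin.elim0 a) ht
  · exact absurd (Finset.mem_filter.2 ⟨Finset.mem_univ _, mem_upperClass_lowerPair i _⟩) h
  · rfl

theorem lowerSum_lowerPair {c₁ c₂ : Colour} (x : Matrix (Fin N) (Fin d) A)
    (i : (lowerPair c₁ c₂).ThroughBlock → Fin N) (j : Fin d) :
    (lowerPair c₁ c₂).lowerSum x i (fun _ => j) =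
      ∑ s : Fin N, c₁.pow (x s j) * c₂.pow (x s j) := by
  classical
  unfold lowerSum
  symm
  refine Finset.sum_bij (fun s _ => fun _ => s) (fun s _ => ?_) (fun s _ s' _ h => ?_)
    (fun t ht => ?_) (fun s _ => ?_)
  · exact Finset.mem_filter.2 ⟨Finset.mem_univ _, const_mem_lowerClass _ i s⟩
  · exact congrFun h (0 : Fin 2)
  · have h := (Finset.mem_filter.1 ht).2.1
    exact ⟨t (0 : Fin 2), Finset.mem_univ _, funext fun a => h _ _ trivial⟩
  · change _ = (List.ofFn fun a : Fin 2 => (![c₁, c₂] a).pow (x s j)).prod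
    simp [List.ofFn_succ]

end TwoColouredPartition

theorem CStarAlgebra.norm_le_one_of_sum_mul_star {D ι : Type*} [CStarAlgebra D] [Fintype ι]
    (y : ι → D) (h : ∑ i, y i * star (y i) = 1) (i : ι) : ‖y i‖ ≤ 1 := by
  let _ : PartialOrder D := CStarAlgebra.spectralOrder D
  have _ : StarOrderedRing D := CStarAlgebra.spectralOrderedRing D
  have h1 : y i * star (y i) ≤ 1 := by
    rw [← h]
    exact Finset.single_le_sum (f := fun i => y i * star (y i))
      (fun i _ => mul_star_self_nonneg (y i)) (Finset.mem_univ i)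
  have h2 : ‖y i * star (y i)‖ ≤ 1 :=
    (CStarAlgebra.norm_le_one_iff_of_nonneg _ (mul_star_self_nonneg (y i))).2 h1
  rw [CStarRing.norm_self_mul_star] at h2
  nlinarith [norm_nonneg (y i)]

theorem CStarSeminorm.le_one_of_relation {E ι : Type*} [Fintype ι]
    (p : CStarSeminorm (FreeStarAlgebra E)) (e : ι → E)
    (h : p (1 - ∑ s, FreeStarAlgebra.gen (e s) * star (FreeStarAlgebra.gen (e s))) = 0) (s : ι) :
    p (FreeStarAlgebra.gen (e s)) ≤ 1 := by
  have h1 : p.inclHom (1 - ∑ s, FreeStarAlgebra.gen (e s) * star (FreeStarAlgebra.gen (e s))) = 0 :=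
    norm_eq_zero.1 ((p.norm_incl _).trans h)
  rw [map_sub, map_one, map_sum, sub_eq_zero] at h1
  simp only [map_mul, map_star] at h1
  rw [← p.norm_incl]
  exact CStarAlgebra.norm_le_one_of_sum_mul_star (fun s => p.inclHom (FreeStarAlgebra.gen (e s)))
    h1.symm s

/-! ### Easy quantum groups and partition quantum spaces -/

open TwoColouredPartition

/-- The matrix of free generators. -/
def freeMatrix (m n : ℕ) : Matrix (Fin m) (Fin n) (FreeStarAlgebra (Fin m × Fin n)) :=
  Matrix.of fun i j => FreeStarAlgebra.gen (i, j)

/-- The relations `R^{Gr}_p(u)` for all `p ∈ P`. -/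
def easyRelations (N : ℕ) (P : Set TwoColouredPartition) :
    Set (FreeStarAlgebra (Fin N × Fin N)) :=
  ⋃ p ∈ P, p.groupRelations (freeMatrix N N)

/-- The relations `R^{Sp}_p(x)` for all `p ∈ P`. -/
def pqsRelations {N d : ℕ} (hd : d ≤ N) (P : Set TwoColouredPartition) :
    Set (FreeStarAlgebra (Fin N × Fin d)) :=
  ⋃ p ∈ P, p.spaceRelations hd (freeMatrix N d)

theorem universalExists_easyRelations (N : ℕ) {P : Set TwoColouredPartition}
    (hP : mixedPairs ⊆ P) : UniversalExists (easyRelations N P) := by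
  refine universalExists_of_gen_le_one _ fun p hp e => ?_
  refine p.le_one_of_relation (fun s => (e.1, s)) (hp _ ?_) e.2
  refine Set.mem_biUnion (hP (Or.inl rfl)) (Or.inl (Or.inl ?_))
  refine ⟨isEmptyElim, isEmptyElim, fun a => Fin.elim0 a, mem_upperClass_lowerPair _ _,
    fun _ => e.1, const_mem_lowerClass _ _ _, ?_⟩
  rw [upperSum_lowerPair, lowerSum_lowerPair]
  rfl

theorem universalExists_pqsRelations {N d : ℕ} (hd : d ≤ N) {P : Set TwoColouredPartition}
    (hP : mixedPairs ⊆ P) : UniversalExists (pqsRelations hd P) := by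
  refine universalExists_of_gen_le_one _ fun p hp e => ?_
  refine p.le_one_of_relation (fun s => (s, e.2)) (hp _ ?_) e.1
  refine Set.mem_biUnion (hP (Or.inl rfl)) (Or.inl (Or.inl ?_))
  refine ⟨isEmptyElim, isEmptyElim, fun a => Fin.elim0 a, fun _ => e.2,
    mem_upperClass_lowerPair _ _, const_mem_lowerClass _ _ (Fin.castLE hd e.2), ?_⟩
  rw [upperSum_lowerPair, lowerSum_lowerPair]
  rfl

/-- The C*-algebra `C(G_N(P))` of the easy quantum group `G_N(P)`. -/
abbrev EasyQuantumGroup (N : ℕ) (P : Set TwoColouredPartition) (hP : mixedPairs ⊆ P) : Type :=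
  UniversalCStarAlgebra (easyRelations N P) (universalExists_easyRelations N hP)

/-- The matrix of generators `u = (u_{ij})` of `C(G_N(P))`. -/
def EasyQuantumGroup.u (N : ℕ) (P : Set TwoColouredPartition) (hP : mixedPairs ⊆ P) :
    Matrix (Fin N) (Fin N) (EasyQuantumGroup N P hP) :=
  Matrix.of fun i j =>
    UniversalCStarAlgebra.gen (easyRelations N P) (universalExists_easyRelations N hP) (i, j)

/-- The C*-algebra `C(X_{N,d}(P))` of the partition quantum space `X_{N,d}(P)` of `d` vectors. -/
abbrev PartitionQuantumSpace {N d : ℕ} (hd : d ≤ N) (P : Set TwoColouredPartition)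
    (hP : mixedPairs ⊆ P) : Type :=
  UniversalCStarAlgebra (pqsRelations hd P) (universalExists_pqsRelations hd hP)

/-- The `d` vectors of generators `x = (x_{ij})` of `C(X_{N,d}(P))`. -/
def PartitionQuantumSpace.x {N d : ℕ} (hd : d ≤ N) (P : Set TwoColouredPartition)
    (hP : mixedPairs ⊆ P) : Matrix (Fin N) (Fin d) (PartitionQuantumSpace hd P hP) :=
  Matrix.of fun i j =>
    UniversalCStarAlgebra.gen (pqsRelations hd P) (universalExists_pqsRelations hd hP) (i, j)

/-! ### Compact matrix quantum groups and matrix-vector actions -/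

/-- The entries of the matrix `x` generate `A` as a unital C*-algebra. -/
def GeneratesCStar {A : Type*} [CStarAlgebra A] {m n : ℕ} (x : Matrix (Fin m) (Fin n) A) : Prop :=
  (StarAlgebra.adjoin ℂ (Set.range fun ij : Fin m × Fin n => x ij.1 ij.2)).topologicalClosure = ⊤

/-- `A` is the C*-algebra `C(G)` of a compact matrix quantum group `G` with matrix of
generators `u`. -/
structure IsCompactMatrixQuantumGroup {A : Type*} [CStarAlgebra A] {N : ℕ}
    (u : Matrix (Fin N) (Fin N) A) : Prop where
  generates : GeneratesCStar u
  isUnit : IsUnit u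
  isUnit_conj : IsUnit (u.map star)
  exists_comul : ∃ Δ : A →⋆ₐ[ℂ] MinTensor A A,
    ∀ i j, Δ (u i j) = ∑ k, MinTensor.tmul (u i k) (u k j)

/-- The unital *-homomorphism `α` is a left matrix-vector action of `G` on `X`:
`α(x_{ij}) = ∑_k u_{ik} ⊗ x_{kj}`. -/
def IsLeftMatrixVectorAction {A B : Type*} [CStarAlgebra A] [CStarAlgebra B] {N d : ℕ}
    (u : Matrix (Fin N) (Fin N) A) (x : Matrix (Fin N) (Fin d) B)
    (α : B →⋆ₐ[ℂ] MinTensor A B) : Prop :=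
  ∀ i j, α (x i j) = ∑ k, MinTensor.tmul (u i k) (x k j)

/-- The unital *-homomorphism `β` is a right matrix-vector action of `G` on `X`:
`β(x_{ij}) = ∑_k u_{ki} ⊗ x_{kj}`. -/
def IsRightMatrixVectorAction {A B : Type*} [CStarAlgebra A] [CStarAlgebra B] {N d : ℕ}
    (u : Matrix (Fin N) (Fin N) A) (x : Matrix (Fin N) (Fin d) B)
    (β : B →⋆ₐ[ℂ] MinTensor A B) : Prop :=
  ∀ i j, β (x i j) = ∑ k, MinTensor.tmul (u k i) (x k j)

end

noncomputable section

open scoped TensorProduct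

/-! ### The universal property -/

namespace Colour

/-! Collect the words of colour `ω` in the entries of `u` into a matrix `W_ω` (`wordMatrix`), and
let `T` be the 0-1 matrix that marks the pairs of labelings lying in `T_i` and `T'_i` for a common
`i` (`classMatrix`). The group relations for `p` say exactly that `T W_ω = W_ω' T`
(`isIntertwining_iff`). Read entrywise, the sum over `t ∈ T_i` of the words `u_{tγ}` depends only on
the class `j` of `γ`. It is a constant `c i j`, and the transposed lower sums have the same
constants.

The space relations compare upper and lower sums of the same untransposed matrix, so the lower sums
of `u` itself are needed as well. The mixed pairs make `u` and its entrywise adjoint unitary, hence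
also every `W_ω`. Therefore the adjoint of `T` intertwines in the opposite direction
(`IsIntertwining.swap`), which gives constants `c'` for the lower sums of `u` and the upper sums of
its transpose. Counting the words over `T'_i × T'_j` in two ways gives `|T'_i| c i j = |T'_j| c' i
j`. All classes of a row have the same size, since labels on through-blocks can be exchanged freely,
so `c' = c` (`IsIntertwining.exists_common_const`).

If the entries of `a` commute with those of `b` and with their adjoints, then words in `a b` expand
like matrix products. If moreover `a` has constants `c`, summing over a class gives `∑_m c i m *
(class sum of b over T_m)`, because labelings outside all classes contribute zero
(`IsClassConstant.classSum_mul`). The coefficients are the same in both rows, so `a b` inherits the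
space relations from `b`. The group relations for a product follow similarly.

Apply this to the two legs of the tensor product: `u` with `u` gives the comultiplication, `u` with
`x` the left action, and the transpose of `u`, whose constants are transposed, the right action. The
universal property turns these matrices into homomorphisms, and density of the *-polynomials gives
uniqueness. -/

theorem map_pow {A B F : Type*} [Star A] [Star B] [FunLike F A B] [StarHomClass F A B] (φ : F)
    (c : Colour) (a : A) : φ (c.pow a) = c.pow (φ a) := by
  cases c
  · rfl
  · exact map_star φ a

theorem flip_pow {A : Type*} [InvolutiveStar A] (c : Colour) (a : A) :
    c.flip.pow a = star (c.pow a) := by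
  cases c
  · rfl
  · exact (star_star a).symm

end Colour

namespace FreeStarAlgebra

variable {E D : Type*} [Ring D] [StarRing D]

/-- The value of a word under the substitution `e ↦ x e`. -/
def wordEval (x : E → D) : FreeMonoid (E × Colour) →* D :=
  FreeMonoid.lift fun a => a.2.pow (x a.1)

theorem wordEval_wordStar (x : E → D) (w : FreeMonoid (E × Colour)) :
    wordEval x (wordStar w) = star (wordEval x w) := by
  induction w using FreeMonoid.inductionOn' with
  | one => exact (map_one _).trans (by rw [map_one, star_one])
  | of_mul a w ih =>
    rw [wordStar_mul, map_mul, ih, map_mul, star_mul]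
    congr 1
    exact (FreeMonoid.lift_eval_of _ _).trans (a.2.flip_pow (x a.1))

variable [Algebra ℂ D]

/-- The value of *-polynomials under the substitution `e ↦ x e`, as an algebra homomorphism. -/
def evalAlgHom (x : E → D) : FreeStarAlgebra E →ₐ[ℂ] D :=
  MonoidAlgebra.lift ℂ D (FreeMonoid (E × Colour)) (wordEval x)

theorem evalAlgHom_term (x : E → D) (w : FreeMonoid (E × Colour)) (c : ℂ) :
    evalAlgHom x (term w c) = c • wordEval x w :=
  MonoidAlgebra.lift_single _ _ _

/-- The value of *-polynomials under the substitution `e ↦ x e`. -/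
def eval [StarModule ℂ D] (x : E → D) : FreeStarAlgebra E →⋆ₐ[ℂ] D :=
  { evalAlgHom x with
    map_star' := fun f => by
      change evalAlgHom x (star f) = star (evalAlgHom x f)
      induction f using FreeStarAlgebra.induction with
      | zero => simp
      | add f g hf hg => rw [star_add, map_add, hf, hg, map_add, star_add]
      | term w c =>
        rw [star_term, evalAlgHom_term, evalAlgHom_term, wordEval_wordStar, star_smul] }

theorem eval_gen [StarModule ℂ D] (x : E → D) (e : E) : eval x (gen e) = x e := by
  change evalAlgHom x (gen e) = x e
  rw [gen, evalAlgHom_term, one_smul]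
  exact FreeMonoid.lift_eval_of _ _

/-- Every word is a product of generators and their adjoints. This yields both generation and
uniqueness of homomorphisms for the universal algebra. -/
theorem mem_adjoin_gen (f : FreeStarAlgebra E) :
    f ∈ StarAlgebra.adjoin ℂ (Set.range (gen : E → FreeStarAlgebra E)) := by
  induction f using FreeStarAlgebra.induction with
  | zero => exact zero_mem _
  | add f g hf hg => exact add_mem hf hg
  | term w c =>
    have h : term w c = c • term w 1 := by rw [smul_term, mul_one]
    rw [h]
    refine SMulMemClass.smul_mem c ?_
    induction w using FreeMonoid.inductionOn' with
    | one => exact one_mem _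
    | of_mul a w ih =>
      have hmul : term (FreeMonoid.of a * w) 1 = term (FreeMonoid.of a) 1 * term w 1 := by
        rw [term_mul, one_mul]
      rw [hmul]
      refine mul_mem ?_ (ih (by rw [smul_term, mul_one]))
      obtain ⟨e, c⟩ := a
      rw [term_of]
      have he : gen e ∈ StarAlgebra.adjoin ℂ (Set.range (gen : E → FreeStarAlgebra E)) :=
        StarAlgebra.subset_adjoin ℂ _ ⟨e, rfl⟩
      cases c
      · exact he
      · exact star_mem he

end FreeStarAlgebra

namespace CStarSeminorm

variable {R D : Type*} [Ring R] [StarRing R] [Algebra ℂ R] [CStarAlgebra D]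

/-- The C*-seminorm `x ↦ ‖φ x‖`. -/
def ofStarAlgHom (φ : R →⋆ₐ[ℂ] D) : CStarSeminorm R where
  toFun x := ‖φ x‖
  map_zero' := by rw [map_zero, norm_zero]
  add_le' x y := by rw [map_add]; exact norm_add_le _ _
  neg' x := by rw [map_neg, norm_neg]
  smul' c x := by rw [map_smul, norm_smul]
  mul_le' x y := by rw [map_mul]; exact norm_mul_le _ _
  star_mul_self' x := by rw [map_mul, map_star, CStarRing.norm_star_mul_self, sq]

variable (p : CStarSeminorm R)

/-- The bound makes `φ` continuous for the seminorm, so it factors through the Hausdorff completion;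
compatibility with the star passes to the limit by density. -/
theorem exists_extension (φ : R →⋆ₐ[ℂ] D) (h : ∀ x, ‖φ x‖ ≤ p x) :
    ∃ ψ : p.Completion →⋆ₐ[ℂ] D, ∀ x, ψ (p.inclHom x) = φ x := by
  let f : p.Carrier →+* D := (φ : R →+* D)
  have hf : Continuous f :=
    (f.toAddMonoidHom.mkNormedAddGroupHom 1 fun x => by
      rw [one_mul]; exact h x).continuous
  let g : UniformSpace.Completion p.Carrier →+* D := UniformSpace.Completion.extensionHom f hf
  have hg : Continuous g := UniformSpace.Completion.continuous_extension
  have hgf : ∀ x : R, g (p.incl x) = φ x := fun x =>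
    UniformSpace.Completion.extensionHom_coe f hf x
  refine ⟨{ g with
    commutes' := fun c => ?_
    map_star' := fun x => ?_ }, hgf⟩
  · exact (hgf (algebraMap ℂ R c)).trans (AlgHomClass.commutes φ c)
  · change g (star x : p.Completion) = star (g x)
    refine p.denseRange_incl.induction_on x (isClosed_eq
      (hg.comp p.continuous_star_completion) (continuous_star.comp hg)) fun a => ?_
    rw [← incl_star, hgf, hgf, map_star]

end CStarSeminorm

namespace UniversalCStarAlgebra

variable {E D : Type*} [CStarAlgebra D] (R : Set (FreeStarAlgebra E)) (hR : UniversalExists R)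

/-- The canonical map from the free *-algebra to `C*(E | R)`. -/
def ofFree : FreeStarAlgebra E →⋆ₐ[ℂ] UniversalCStarAlgebra R hR :=
  (CStarSeminorm.sup (relationSeminorms R) hR).inclHom

theorem ofFree_eq_zero {r : FreeStarAlgebra E} (hr : r ∈ R) : ofFree R hR r = 0 := by
  refine norm_eq_zero.1 ((CStarSeminorm.norm_incl _ r).trans ?_)
  change (⨆ p : relationSeminorms R, p.1 r) = 0
  exact (congrArg _ (funext fun p : relationSeminorms R => p.2 r hr)).trans Real.iSup_const_zero

/-- The C*-seminorm `f ↦ ‖eval x f‖` kills the relations, so it is one of those over which the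
supremum is taken. Hence evaluation is contractive for the universal seminorm and extends. -/
theorem exists_lift (x : E → D) (hx : ∀ r ∈ R, FreeStarAlgebra.eval x r = 0) :
    ∃ φ : UniversalCStarAlgebra R hR →⋆ₐ[ℂ] D, ∀ e, φ (gen R hR e) = x e := by
  obtain ⟨φ, hφ⟩ := CStarSeminorm.exists_extension (CStarSeminorm.sup (relationSeminorms R) hR)
    (FreeStarAlgebra.eval x) fun f =>
      le_ciSup (hR f) ⟨CStarSeminorm.ofStarAlgHom (FreeStarAlgebra.eval x), fun r hr =>
        norm_eq_zero.2 (hx r hr)⟩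
  exact ⟨φ, fun e => (hφ _).trans (FreeStarAlgebra.eval_gen x e)⟩

theorem topologicalClosure_adjoin_gen :
    (StarAlgebra.adjoin ℂ (Set.range (gen R hR))).topologicalClosure = ⊤ := by
  refine eq_top_iff.2 fun y _ => ?_
  refine closure_mono ?_ (CStarSeminorm.denseRange_incl _ y)
  rintro _ ⟨f, rfl⟩
  have h := (StarAlgHom.map_adjoin (ofFree R hR) (Set.range FreeStarAlgebra.gen)).le
    ⟨f, FreeStarAlgebra.mem_adjoin_gen f, rfl⟩
  rwa [← Set.range_comp] at h

/-- Unital *-homomorphisms of C*-algebras are contractive, so agreement on the dense *-algebra of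
polynomials in the generators is enough. -/
theorem hom_ext {φ ψ : UniversalCStarAlgebra R hR →⋆ₐ[ℂ] D}
    (h : ∀ e, φ (gen R hR e) = ψ (gen R hR e)) : φ = ψ := by
  have hφ : Continuous φ := AddMonoidHomClass.continuous_of_bound φ 1 fun y => by
    rw [one_mul]; exact NonUnitalStarAlgHom.norm_apply_le φ y
  have hψ : Continuous ψ := AddMonoidHomClass.continuous_of_bound ψ 1 fun y => by
    rw [one_mul]; exact NonUnitalStarAlgHom.norm_apply_le ψ y
  have hfree : φ.comp (ofFree R hR) = ψ.comp (ofFree R hR) := by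
    refine StarAlgHom.ext_of_adjoin_eq_top (s := Set.range FreeStarAlgebra.gen)
      (eq_top_iff.2 fun f _ => FreeStarAlgebra.mem_adjoin_gen f) ?_
    rintro _ ⟨e, rfl⟩
    exact h e
  refine StarAlgHom.ext fun y => ?_
  refine congrFun ((CStarSeminorm.denseRange_incl _).equalizer hφ hψ (funext fun f => ?_)) y
  exact DFunLike.congr_fun hfree f

end UniversalCStarAlgebra

/-! ### The two legs of the minimal tensor product -/

namespace MinTensor

universe u v

variable (A : Type u) (B : Type v) [CStarAlgebra A] [CStarAlgebra B]

/-- The unital *-homomorphism `a ↦ a ⊗ 1`. -/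
def inLeft : A →⋆ₐ[ℂ] MinTensor A B :=
  (CStarSeminorm.sup (spatialSeminorms A B) (bddAbove_spatialSeminorms A B)).inclHom.comp
    { (Algebra.TensorProduct.includeLeft : A →ₐ[ℂ] A ⊗[ℂ] B) with
      map_star' := fun a => by
        change star a ⊗ₜ[ℂ] (1 : B) = star (a ⊗ₜ[ℂ] (1 : B))
        rw [TensorProduct.star_tmul, star_one] }

/-- The unital *-homomorphism `b ↦ 1 ⊗ b`. -/
def inRight : B →⋆ₐ[ℂ] MinTensor A B :=
  (CStarSeminorm.sup (spatialSeminorms A B) (bddAbove_spatialSeminorms A B)).inclHom.comp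
    { (Algebra.TensorProduct.includeRight : B →ₐ[ℂ] A ⊗[ℂ] B) with
      map_star' := fun b => by
        change (1 : A) ⊗ₜ[ℂ] star b = star ((1 : A) ⊗ₜ[ℂ] b)
        rw [TensorProduct.star_tmul, star_one] }

variable {A B}

theorem inLeft_mul_inRight (a : A) (b : B) : inLeft A B a * inRight A B b = tmul a b := by
  refine (map_mul (CStarSeminorm.inclHom _) (a ⊗ₜ[ℂ] (1 : B)) ((1 : A) ⊗ₜ[ℂ] b)).symm.trans ?_
  rw [Algebra.TensorProduct.tmul_mul_tmul, mul_one, one_mul]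
  rfl

/-- This commutation and the product formula above are the only properties of the minimal tensor
product that the construction of the homomorphisms uses. -/
theorem commute_inLeft_inRight (a : A) (b : B) : Commute (inLeft A B a) (inRight A B b) := by
  refine (inLeft_mul_inRight a b).trans ?_
  refine Eq.trans ?_
    (map_mul (CStarSeminorm.inclHom _) ((1 : A) ⊗ₜ[ℂ] b) (a ⊗ₜ[ℂ] (1 : B)))
  rw [Algebra.TensorProduct.tmul_mul_tmul, mul_one, one_mul]
  rfl

end MinTensor

/-! ### Words in the entries of a matrix -/

section Words

theorem Fin.ite_cons_eq {k : ℕ} {ι A : Type*} [DecidableEq ι] [Zero A] [One A] (t s : Fin (k + 1) → ι) :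
    (if t = s then (1 : A) else 0) =
      if t 0 = s 0 then (if Fin.tail t = Fin.tail s then 1 else 0) else 0 := by
  rw [← ite_and]
  refine if_congr ⟨fun h => by simp [h], fun h => ?_⟩ rfl rfl
  rw [← Fin.cons_self_tail t, ← Fin.cons_self_tail s, h.1, h.2]

variable {m n r : ℕ} {A : Type*} [Ring A] [StarRing A]

/-- The product `x_{t_1 s_1}^{ω_1} ⋯ x_{t_k s_k}^{ω_k}`. -/
def matrixWord {k : ℕ} (ω : Fin k → Colour) (x : Matrix (Fin m) (Fin n) A) (t : Fin k → Fin m)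
    (s : Fin k → Fin n) : A :=
  (List.ofFn fun a => (ω a).pow (x (t a) (s a))).prod

theorem matrixWord_zero (ω : Fin 0 → Colour) (x : Matrix (Fin m) (Fin n) A) (t : Fin 0 → Fin m)
    (s : Fin 0 → Fin n) : matrixWord ω x t s = 1 := by
  simp [matrixWord]

theorem matrixWord_succ {k : ℕ} (ω : Fin (k + 1) → Colour) (x : Matrix (Fin m) (Fin n) A)
    (t : Fin (k + 1) → Fin m) (s : Fin (k + 1) → Fin n) :
    matrixWord ω x t s =
      (ω 0).pow (x (t 0) (s 0)) * matrixWord (Fin.tail ω) x (Fin.tail t) (Fin.tail s) := by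
  simp [matrixWord, List.ofFn_succ, Fin.tail]

theorem sum_fin_succ_pi {M ι : Type*} [AddCommMonoid M] [Fintype ι] {k : ℕ}
    (f : (Fin (k + 1) → ι) → M) :
    ∑ s, f s = ∑ s₀ : ι, ∑ s : Fin k → ι, f (Fin.cons s₀ s) := by
  rw [← Fintype.sum_prod_type']
  exact (Fintype.sum_equiv (Fin.consEquiv fun _ => ι) _ _ fun _ => rfl).symm

theorem map_matrixWord {B : Type*} [Ring B] [StarRing B] [Algebra ℂ A] [Algebra ℂ B]
    (φ : A →⋆ₐ[ℂ] B) {k : ℕ} (ω : Fin k → Colour) (x : Matrix (Fin m) (Fin n) A)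
    (t : Fin k → Fin m) (s : Fin k → Fin n) :
    φ (matrixWord ω x t s) = matrixWord ω (x.map φ) t s := by
  simp only [matrixWord, map_list_prod, List.map_ofFn, Function.comp_def, Colour.map_pow,
    Matrix.map_apply]

/-- For the exponent `*`, the adjoint reverses the two factors of each summand and commutation
restores their order. -/
theorem Colour.pow_matrix_mul {a : Matrix (Fin m) (Fin n) A} {b : Matrix (Fin n) (Fin r) A}
    (h : ∀ (c : Colour) i j k l, Commute (a i j) (c.pow (b k l))) (c : Colour) (i : Fin m)
    (j : Fin r) : c.pow ((a * b) i j) = ∑ s, c.pow (a i s) * c.pow (b s j) := by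
  cases c
  · exact Matrix.mul_apply
  · change star ((a * b) i j) = ∑ s, star (a i s) * star (b s j)
    rw [Matrix.mul_apply, star_sum]
    refine Finset.sum_congr rfl fun s _ => ?_
    rw [star_mul]
    exact ((h .white i s s j).star_star).eq.symm

theorem Colour.commute_pow_of {a b : A} (h : ∀ c : Colour, Commute a (c.pow b)) (c c' : Colour) :
    Commute (c.pow a) (c'.pow b) := by
  cases c
  · exact h c'
  · have := (h c'.flip).star_star
    rwa [Colour.flip_pow, star_star] at this

theorem commute_matrixWord {b : Matrix (Fin m) (Fin n) A} {z : A}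
    (h : ∀ (c : Colour) i j, Commute z (c.pow (b i j))) {k : ℕ} (ω : Fin k → Colour)
    (t : Fin k → Fin m) (s : Fin k → Fin n) : Commute z (matrixWord ω b t s) := by
  refine Commute.list_prod_right _ _ fun y hy => ?_
  obtain ⟨a, rfl⟩ := List.mem_ofFn.1 hy
  exact h _ _ _

/-- Words in a product of two matrices with commuting entries. -/
theorem matrixWord_mul {a : Matrix (Fin m) (Fin n) A} {b : Matrix (Fin n) (Fin r) A}
    (h : ∀ (c : Colour) i j k l, Commute (a i j) (c.pow (b k l))) {k : ℕ} (ω : Fin k → Colour)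
    (t : Fin k → Fin m) (s : Fin k → Fin r) :
    matrixWord ω (a * b) t s = ∑ v, matrixWord ω a t v * matrixWord ω b v s := by
  induction k with
  | zero => simp [matrixWord_zero]
  | succ k ih =>
    rw [sum_fin_succ_pi, matrixWord_succ, ih, Colour.pow_matrix_mul h, Finset.sum_mul_sum]
    refine Finset.sum_congr rfl fun v₀ _ => Finset.sum_congr rfl fun v _ => ?_
    rw [matrixWord_succ ω a, matrixWord_succ ω b, Fin.cons_zero, Fin.tail_cons]
    -- The first letter from `b` has to move past the remaining word in `a`.
    have hc : Commute ((ω 0).pow (b v₀ (s 0))) (matrixWord (Fin.tail ω) a (Fin.tail t) v) :=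
      commute_matrixWord (fun c i j =>
        (Colour.commute_pow_of (fun c' => h c' i j v₀ (s 0)) c (ω 0)).symm) _ _ _
    rw [mul_assoc, mul_assoc, ← mul_assoc _ _ (matrixWord (Fin.tail ω) b v _), hc.eq, mul_assoc]

/-- `x` and its entrywise adjoint are unitary. -/
structure IsBiunitary (x : Matrix (Fin n) (Fin n) A) : Prop where
  sum_star_mul : ∀ (c : Colour) i j,
    ∑ s, star (c.pow (x s i)) * c.pow (x s j) = if i = j then 1 else 0
  sum_mul_star : ∀ (c : Colour) i j,
    ∑ s, c.pow (x i s) * star (c.pow (x j s)) = if i = j then 1 else 0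

theorem IsBiunitary.sum_star_matrixWord_mul {x : Matrix (Fin n) (Fin n) A} (hx : IsBiunitary x)
    {k : ℕ} (ω : Fin k → Colour) (t s : Fin k → Fin n) :
    ∑ v, star (matrixWord ω x v t) * matrixWord ω x v s = if t = s then 1 else 0 := by
  induction k with
  | zero => simp [matrixWord_zero, Subsingleton.elim t s]
  | succ k ih =>
    -- In `star (word) * word` the first letters meet in the middle, so the sum over the first index
    -- is made the inner one and evaluated first.
    rw [sum_fin_succ_pi, Finset.sum_comm, Fin.ite_cons_eq, ← ih (Fin.tail ω)]
    simp only [matrixWord_succ ω x, Fin.cons_zero, Fin.tail_cons, star_mul]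
    have h : ∀ v : Fin k → Fin n, ∑ v₀, star (matrixWord (Fin.tail ω) x v (Fin.tail t)) *
        star ((ω 0).pow (x v₀ (t 0))) *
          ((ω 0).pow (x v₀ (s 0)) * matrixWord (Fin.tail ω) x v (Fin.tail s)) =
        if t 0 = s 0 then star (matrixWord (Fin.tail ω) x v (Fin.tail t)) *
          matrixWord (Fin.tail ω) x v (Fin.tail s) else 0 := by
      intro v
      have := congrArg (fun z => star (matrixWord (Fin.tail ω) x v (Fin.tail t)) * z *
        matrixWord (Fin.tail ω) x v (Fin.tail s)) (hx.sum_star_mul (ω 0) (t 0) (s 0))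
      simp only [Finset.mul_sum, Finset.sum_mul, mul_ite, ite_mul, mul_one, mul_zero, zero_mul]
        at this
      rw [← this]
      exact Finset.sum_congr rfl fun _ _ => by simp only [mul_assoc]
    simp only [h]
    split_ifs <;> simp

theorem IsBiunitary.mul_star_ite {x : Matrix (Fin n) (Fin n) A} (hx : IsBiunitary x) (c : Colour)
    (i j : Fin n) (q : Prop) [Decidable q] :
    ∑ s, c.pow (x i s) * (if q then 1 else 0) * star (c.pow (x j s)) =
      if i = j then (if q then 1 else 0) else 0 := by
  split_ifs with hq h h
  · simpa [h] using hx.sum_mul_star c i j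
  · simpa [h] using hx.sum_mul_star c i j
  · simp
  · simp

theorem IsBiunitary.sum_matrixWord_mul_star {x : Matrix (Fin n) (Fin n) A} (hx : IsBiunitary x)
    {k : ℕ} (ω : Fin k → Colour) (t s : Fin k → Fin n) :
    ∑ v, matrixWord ω x t v * star (matrixWord ω x s v) = if t = s then 1 else 0 := by
  induction k with
  | zero => simp [matrixWord_zero, Subsingleton.elim t s]
  | succ k ih =>
    -- Here the tails meet in the middle, so the induction hypothesis supplies the inner sum and the
    -- first letter is evaluated last.
    rw [sum_fin_succ_pi, Fin.ite_cons_eq, ← hx.mul_star_ite (ω 0), ← ih (Fin.tail ω)]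
    refine Finset.sum_congr rfl fun v₀ _ => ?_
    simp only [matrixWord_succ ω x, Fin.cons_zero, Fin.tail_cons, star_mul, Finset.mul_sum,
      Finset.sum_mul, mul_assoc]

end Words

/-! ### Sums of words over classes of labelings -/

section ClassSums

variable {k l n d : ℕ} {ι A : Type*} [Ring A] [StarRing A]

open scoped Classical in
/-- The sum of the words `x_{t_1 γ_1}^{ω_1} ⋯ x_{t_k γ_k}^{ω_k}` over `t ∈ C i`. -/
def classSum (ω : Fin k → Colour) (C : ι → Set (Fin k → Fin n)) (x : Matrix (Fin n) (Fin d) A)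
    (i : ι) (γ : Fin k → Fin d) : A :=
  ∑ t : Fin k → Fin n with t ∈ C i, matrixWord ω x t γ

theorem map_classSum {B : Type*} [Ring B] [StarRing B] [Algebra ℂ A] [Algebra ℂ B]
    (φ : A →⋆ₐ[ℂ] B) (ω : Fin k → Colour) (C : ι → Set (Fin k → Fin n))
    (x : Matrix (Fin n) (Fin d) A) (i : ι) (γ : Fin k → Fin d) :
    φ (classSum ω C x i γ) = classSum ω C (x.map φ) i γ := by
  simp only [classSum, map_sum, map_matrixWord]

/-- The class sums `classSum ω C x i γ` depend only on the class of `γ`, and vanish if `γ` lies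
in no class. -/
structure IsClassConstant (ω : Fin k → Colour) (C : ι → Set (Fin k → Fin n))
    (x : Matrix (Fin n) (Fin n) A) (c : ι → ι → A) : Prop where
  eq_of_mem : ∀ i j γ, γ ∈ C j → classSum ω C x i γ = c i j
  eq_zero : ∀ i γ, (∀ j, γ ∉ C j) → classSum ω C x i γ = 0

theorem IsClassConstant.map {B : Type*} [Ring B] [StarRing B] [Algebra ℂ A] [Algebra ℂ B]
    {ω : Fin k → Colour} {C : ι → Set (Fin k → Fin n)}
    {x : Matrix (Fin n) (Fin n) A} {c : ι → ι → A} (h : IsClassConstant ω C x c)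
    (φ : A →⋆ₐ[ℂ] B) : IsClassConstant ω C (x.map φ) fun i j => φ (c i j) where
  eq_of_mem i j γ hγ := by rw [← map_classSum, h.eq_of_mem i j γ hγ]
  eq_zero i γ hγ := by rw [← map_classSum, h.eq_zero i γ hγ, map_zero]

/-- The classes `C i` are pairwise disjoint. -/
def DisjointClasses (C : ι → Set (Fin k → Fin n)) : Prop :=
  ∀ i j t, t ∈ C i → t ∈ C j → i = j

/-- Expand the words of `a * b` over intermediate labelings `v` and group the `v` by their class: on
class `m` the factor from `a` is the constant `c i m`, and outside all classes it is zero. -/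
theorem IsClassConstant.classSum_mul [Fintype ι] {ω : Fin k → Colour}
    {C : ι → Set (Fin k → Fin n)} (hC : DisjointClasses C)
    {a : Matrix (Fin n) (Fin n) A} {b : Matrix (Fin n) (Fin d) A} {c : ι → ι → A}
    (ha : IsClassConstant ω C a c)
    (h : ∀ (c : Colour) i j k l, Commute (a i j) (c.pow (b k l))) (i : ι) (γ : Fin k → Fin d) :
    classSum ω C (a * b) i γ = ∑ m, c i m * classSum ω C b m γ := by
  classical
  have h1 : classSum ω C (a * b) i γ = ∑ v, classSum ω C a i v * matrixWord ω b v γ := by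
    simp only [classSum, matrixWord_mul h, Finset.sum_mul]
    exact Finset.sum_comm
  have h2 : ∀ m, c i m * classSum ω C b m γ =
      ∑ v, if v ∈ C m then classSum ω C a i v * matrixWord ω b v γ else 0 := by
    intro m
    rw [← Finset.sum_filter]
    conv_lhs => rw [classSum, Finset.mul_sum]
    refine (Finset.sum_congr (by congr) fun v hv => ?_)
    rw [ha.eq_of_mem i m v (Finset.mem_filter.1 hv).2]
  rw [h1, Finset.sum_congr rfl fun m _ => h2 m, Finset.sum_comm]
  refine Finset.sum_congr rfl fun v _ => ?_
  -- By disjointness `v` is counted for exactly one `m`, or for none, in which case its coefficient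
  -- vanishes.
  by_cases hv : ∃ m, v ∈ C m
  · obtain ⟨m, hm⟩ := hv
    rw [Finset.sum_eq_single m (fun m' _ hm' => if_neg fun h' => hm' (hC _ _ _ h' hm))
      fun h' => absurd (Finset.mem_univ m) h', if_pos hm]
  · rw [not_exists] at hv
    rw [ha.eq_zero i v hv, zero_mul]
    simp

/-- The relations which say that the matrix `(δ_{t ∈ C i, t' ∈ C' i})` intertwines the words in
`u` with colours `ω` and `ω'`. -/
structure IsIntertwining (ω : Fin k → Colour) (C : ι → Set (Fin k → Fin n)) (ω' : Fin l → Colour)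
    (C' : ι → Set (Fin l → Fin n)) (u : Matrix (Fin n) (Fin n) A) : Prop where
  eq : ∀ i j, ∀ γ ∈ C j, ∀ γ' ∈ C' i, classSum ω C u i γ = classSum ω' C' u.transpose j γ'
  upper : ∀ i γ, (∀ j, γ ∉ C j) → classSum ω C u i γ = 0
  lower : ∀ j γ', (∀ i, γ' ∉ C' i) → classSum ω' C' u.transpose j γ' = 0

open scoped Classical in
/-- The matrix with entry `1` where the two labelings lie in classes with the same index. -/
def classMatrix (A : Type*) [Ring A] (C : ι → Set (Fin k → Fin n)) (C' : ι → Set (Fin l → Fin n)) :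
    Matrix (Fin l → Fin n) (Fin k → Fin n) A :=
  Matrix.of fun t' t => if ∃ i, t ∈ C i ∧ t' ∈ C' i then 1 else 0

/-- The matrix of all words with colours `ω`. -/
def wordMatrix (ω : Fin k → Colour) (u : Matrix (Fin n) (Fin n) A) :
    Matrix (Fin k → Fin n) (Fin k → Fin n) A :=
  Matrix.of fun t s => matrixWord ω u t s

variable {ω : Fin k → Colour} {C : ι → Set (Fin k → Fin n)} {ω' : Fin l → Colour}
  {C' : ι → Set (Fin l → Fin n)} {u : Matrix (Fin n) (Fin n) A}

/-- By disjointness the index of `γ'` is unique, so row `γ'` of the class matrix is the indicator of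
`C i`. -/
theorem classMatrix_mul_wordMatrix (hC' : DisjointClasses C') {i : ι} {γ' : Fin l → Fin n}
    (hγ' : γ' ∈ C' i) (γ : Fin k → Fin n) :
    (classMatrix A C C' * wordMatrix ω u) γ' γ = classSum ω C u i γ := by
  rw [Matrix.mul_apply, classSum, Finset.sum_filter]
  refine Finset.sum_congr rfl fun t _ => ?_
  have h : (∃ i, t ∈ C i ∧ γ' ∈ C' i) ↔ t ∈ C i :=
    ⟨fun ⟨j, hj, hj'⟩ => hC' _ _ _ hj' hγ' ▸ hj, fun h => ⟨i, h, hγ'⟩⟩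
  simp only [classMatrix, wordMatrix, Matrix.of_apply, ite_mul, one_mul, zero_mul]
  classical exact if_congr h rfl rfl

theorem classMatrix_mul_wordMatrix_eq_zero {γ' : Fin l → Fin n} (hγ' : ∀ i, γ' ∉ C' i)
    (γ : Fin k → Fin n) : (classMatrix A C C' * wordMatrix ω u) γ' γ = 0 := by
  rw [Matrix.mul_apply]
  refine Finset.sum_eq_zero fun t _ => ?_
  have h : ¬ ∃ i, t ∈ C i ∧ γ' ∈ C' i := fun ⟨i, _, h⟩ => hγ' i h
  simp only [classMatrix, Matrix.of_apply, h, if_false, zero_mul]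

theorem wordMatrix_mul_classMatrix (hC : DisjointClasses C) {j : ι} {γ : Fin k → Fin n}
    (hγ : γ ∈ C j) (γ' : Fin l → Fin n) :
    (wordMatrix ω' u * classMatrix A C C') γ' γ = classSum ω' C' u.transpose j γ' := by
  rw [Matrix.mul_apply, classSum, Finset.sum_filter]
  refine Finset.sum_congr rfl fun t _ => ?_
  have h : (∃ i, γ ∈ C i ∧ t ∈ C' i) ↔ t ∈ C' j :=
    ⟨fun ⟨i, hi, hi'⟩ => hC _ _ _ hi hγ ▸ hi', fun h => ⟨j, hγ, h⟩⟩
  simp only [classMatrix, wordMatrix, Matrix.of_apply, mul_ite, mul_one, mul_zero]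
  classical exact if_congr h rfl rfl

theorem wordMatrix_mul_classMatrix_eq_zero {γ : Fin k → Fin n} (hγ : ∀ j, γ ∉ C j)
    (γ' : Fin l → Fin n) : (wordMatrix ω' u * classMatrix A C C') γ' γ = 0 := by
  rw [Matrix.mul_apply]
  refine Finset.sum_eq_zero fun t _ => ?_
  have h : ¬ ∃ i, γ ∈ C i ∧ t ∈ C' i := fun ⟨i, h, _⟩ => hγ i h
  simp only [classMatrix, Matrix.of_apply, h, if_false, mul_zero]

/-- The three kinds of relations are the entries of the matrix equation, sorted by whether the row
and column labelings lie in classes; if neither does, both sides vanish. Nonemptiness serves the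
converse: a relation with index `i` can only be read off from a row that lies in class `i`, and
similarly for columns. -/
theorem isIntertwining_iff (hC : DisjointClasses C) (hC' : DisjointClasses C')
    (h0 : ∀ i, (C i).Nonempty) (h0' : ∀ i, (C' i).Nonempty) :
    IsIntertwining ω C ω' C' u ↔
      classMatrix A C C' * wordMatrix ω u = wordMatrix ω' u * classMatrix A C C' := by
  constructor
  · intro h
    ext γ' γ
    by_cases hγ' : ∃ i, γ' ∈ C' i
    · obtain ⟨i, hi⟩ := hγ'
      rw [classMatrix_mul_wordMatrix hC' hi]
      by_cases hγ : ∃ j, γ ∈ C j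
      · obtain ⟨j, hj⟩ := hγ
        rw [wordMatrix_mul_classMatrix hC hj]
        exact h.eq i j γ hj γ' hi
      · rw [not_exists] at hγ
        rw [wordMatrix_mul_classMatrix_eq_zero hγ, h.upper i γ hγ]
    · rw [not_exists] at hγ'
      rw [classMatrix_mul_wordMatrix_eq_zero hγ']
      by_cases hγ : ∃ j, γ ∈ C j
      · obtain ⟨j, hj⟩ := hγ
        rw [wordMatrix_mul_classMatrix hC hj, h.lower j γ' hγ']
      · rw [not_exists] at hγ
        rw [wordMatrix_mul_classMatrix_eq_zero hγ]
  · intro h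
    refine ⟨fun i j γ hγ γ' hγ' => ?_, fun i γ hγ => ?_, fun j γ' hγ' => ?_⟩
    · rw [← classMatrix_mul_wordMatrix hC' hγ', h, wordMatrix_mul_classMatrix hC hγ]
    · obtain ⟨γ', hγ'⟩ := h0' i
      rw [← classMatrix_mul_wordMatrix hC' hγ', h, wordMatrix_mul_classMatrix_eq_zero hγ]
    · obtain ⟨γ, hγ⟩ := h0 j
      rw [← wordMatrix_mul_classMatrix hC hγ, ← h, classMatrix_mul_wordMatrix_eq_zero hγ']

theorem conjTranspose_classMatrix :
    (classMatrix A C C').conjTranspose = classMatrix A C' C := by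
  ext t t'
  simp only [classMatrix, Matrix.conjTranspose_apply, Matrix.of_apply, apply_ite star, star_one,
    star_zero]
  classical exact if_congr (exists_congr fun _ => and_comm) rfl rfl

theorem IsBiunitary.conjTranspose_mul_wordMatrix (hu : IsBiunitary u) (ω : Fin k → Colour) :
    (wordMatrix ω u).conjTranspose * wordMatrix ω u = 1 := by
  ext t s
  rw [Matrix.mul_apply, Matrix.one_apply]
  exact hu.sum_star_matrixWord_mul ω t s

theorem IsBiunitary.wordMatrix_mul_conjTranspose (hu : IsBiunitary u) (ω : Fin k → Colour) :
    wordMatrix ω u * (wordMatrix ω u).conjTranspose = 1 := by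
  ext t s
  rw [Matrix.mul_apply, Matrix.one_apply]
  exact hu.sum_matrixWord_mul_star ω t s

/-- The adjoint of an intertwiner is an intertwiner in the other direction. -/
theorem IsIntertwining.swap (h : IsIntertwining ω C ω' C' u) (hu : IsBiunitary u)
    (hC : DisjointClasses C) (hC' : DisjointClasses C')
    (h0 : ∀ i, (C i).Nonempty) (h0' : ∀ i, (C' i).Nonempty) :
    IsIntertwining ω' C' ω C u := by
  rw [isIntertwining_iff hC hC' h0 h0'] at h
  rw [isIntertwining_iff hC' hC h0' h0]
  -- Multiply the intertwining equation by the inverses of the two unitary word matrices; taking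
  -- adjoints afterwards reverses the direction.
  have h1 : (wordMatrix ω' u).conjTranspose * classMatrix A C C' =
      classMatrix A C C' * (wordMatrix ω u).conjTranspose := by
    have h2 := congrArg (fun M => (wordMatrix ω' u).conjTranspose * M *
      (wordMatrix ω u).conjTranspose) h
    rw [Matrix.mul_assoc, Matrix.mul_assoc, hu.wordMatrix_mul_conjTranspose, Matrix.mul_one,
      ← Matrix.mul_assoc, hu.conjTranspose_mul_wordMatrix, Matrix.one_mul] at h2
    exact h2
  have h3 := congrArg Matrix.conjTranspose h1
  rwa [Matrix.conjTranspose_mul, Matrix.conjTranspose_mul, Matrix.conjTranspose_conjTranspose,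
    Matrix.conjTranspose_conjTranspose, conjTranspose_classMatrix] at h3

/-- In the relation `eq`, one side does not involve `γ'` and the other does not involve `γ`, so both
depend only on the class indices. Representatives of the classes define the constants. -/
theorem IsIntertwining.exists_const (h : IsIntertwining ω C ω' C' u)
    (h0 : ∀ i, (C i).Nonempty) (h0' : ∀ i, (C' i).Nonempty) :
    ∃ c : ι → ι → A, IsClassConstant ω C u c ∧
      IsClassConstant ω' C' u.transpose fun i j => c j i := by
  choose g hg using h0
  choose g' hg' using h0'
  refine ⟨fun i j => classSum ω C u i (g j), ⟨fun i j γ hγ => ?_, h.upper⟩,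
    ⟨fun i j γ' hγ' => ?_, h.lower⟩⟩
  · rw [h.eq i j γ hγ _ (hg' i), h.eq i j _ (hg j) _ (hg' i)]
  · exact (h.eq j i _ (hg i) _ hγ').symm

/-- All four kinds of class sums of an intertwining biunitary matrix are given by the same
constants, provided that the lower classes have the same size. -/
theorem IsIntertwining.exists_common_const [Algebra ℂ A] (h : IsIntertwining ω C ω' C' u)
    (hu : IsBiunitary u) (hC : DisjointClasses C) (hC' : DisjointClasses C')
    (h0 : ∀ i, (C i).Nonempty) (h0' : ∀ i, (C' i).Nonempty)
    (hcard : ∀ i j, (C' i).ncard = (C' j).ncard) :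
    ∃ c : ι → ι → A, IsClassConstant ω C u c ∧ IsClassConstant ω' C' u c ∧
      IsClassConstant ω C u.transpose (fun i j => c j i) ∧
      IsClassConstant ω' C' u.transpose fun i j => c j i := by
  classical
  obtain ⟨c, h1, h2⟩ := h.exists_const h0 h0'
  obtain ⟨c', h3, h4⟩ := (h.swap hu hC hC' h0 h0').exists_const h0' h0
  -- Both constants are recovered from the sum of the words `u_{ts}` over `t ∈ C' i` and `s ∈ C' j`:
  -- summing along rows gives `|C' i| c i j`, along columns `|C' j| c' i j`. The cardinalities agree
  -- and are nonzero, hence can be cancelled over `ℂ`.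
  have hcc : c' = c := by
    ext i j
    have hL : ∑ s : Fin l → Fin n with s ∈ C' i, classSum ω' C' u.transpose j s =
        ((C' i).ncard : ℂ) • c i j := by
      rw [Finset.sum_congr rfl fun s hs => h2.eq_of_mem j i s (Finset.mem_filter.1 hs).2,
        Finset.sum_const, Nat.cast_smul_eq_nsmul, Set.ncard_eq_toFinset_card']
      congr 2
      ext
      simp
    have hR : ∑ s : Fin l → Fin n with s ∈ C' j, classSum ω' C' u i s =
        ((C' j).ncard : ℂ) • c' i j := by
      rw [Finset.sum_congr rfl fun s hs => h3.eq_of_mem i j s (Finset.mem_filter.1 hs).2,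
        Finset.sum_const, Nat.cast_smul_eq_nsmul, Set.ncard_eq_toFinset_card']
      congr 2
      ext
      simp
    have hLR : ∑ s : Fin l → Fin n with s ∈ C' i, classSum ω' C' u.transpose j s =
        ∑ s : Fin l → Fin n with s ∈ C' j, classSum ω' C' u i s := by
      simp only [classSum]
      rw [Finset.sum_comm]
      refine Finset.sum_congr (by congr) fun t _ => Finset.sum_congr (by congr) fun s _ => rfl
    have hne : ((C' j).ncard : ℂ) ≠ 0 :=
      Nat.cast_ne_zero.2 ((Set.ncard_pos (Set.toFinite _)).2 (h0' j)).ne'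
    rw [hL, hR, hcard i j] at hLR
    exact (smul_right_injective A hne hLR).symm
  subst hcc
  exact ⟨c', h1, h3, h4, h2⟩

end ClassSums

/-! ### Labelings with prescribed values on some blocks -/

section RowClass

variable {X Q : Type*} {n : ℕ} (q : X → Q) (S : Q → Prop)

/-- The labelings of `X` that are constant on the fibres of `q` and have the values given by `i`
on the fibres over the points of `S`. -/
def rowClass (i : {b // S b} → Fin n) : Set (X → Fin n) :=
  {t | (∀ a b, q a = q b → t a = t b) ∧ ∀ a (b : {b // S b}), q a = b.1 → t a = i b}

open scoped Classical in
/-- Change the values over the points of `S` to those given by `i`. -/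
def relabel (i : {b // S b} → Fin n) (t : X → Fin n) : X → Fin n :=
  fun a => if h : S (q a) then i ⟨q a, h⟩ else t a

variable {q S}

theorem relabel_mem (i : {b // S b} → Fin n) {t : X → Fin n}
    (ht : ∀ a b, q a = q b → t a = t b) : relabel q S i t ∈ rowClass q S i := by
  refine ⟨fun a b h => ?_, fun a b h => ?_⟩
  · unfold relabel
    rw [ht a b h]
    split_ifs with h1 h2 h2
    · exact congrArg i (Subtype.ext h)
    · exact absurd (h ▸ h1) h2
    · exact absurd (h ▸ h2) h1
    · rfl
  · have hS : S (q a) := h ▸ b.2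
    simp only [relabel, hS, dif_pos]
    exact congrArg i (Subtype.ext h)

theorem rowClass_nonempty (hn : 0 < n) (i : {b // S b} → Fin n) : (rowClass q S i).Nonempty :=
  ⟨_, relabel_mem i (t := fun _ => ⟨0, hn⟩) fun _ _ _ => rfl⟩

/-- Relabeling to `j` is injective on the class of `i`: values off `S` are kept, and those over `S`
are already prescribed by `i`. -/
theorem ncard_rowClass_le [Finite X] (i j : {b // S b} → Fin n) :
    (rowClass q S i).ncard ≤ (rowClass q S j).ncard := by
  refine Set.ncard_le_ncard_of_injOn (relabel q S j) (fun t ht => relabel_mem j ht.1)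
    (fun t ht s hs h => funext fun a => ?_) (Set.toFinite _)
  by_cases hS : S (q a)
  · rw [ht.2 a ⟨q a, hS⟩ rfl, hs.2 a ⟨q a, hS⟩ rfl]
  · have := congrFun h a
    simpa only [relabel, hS, dif_neg, not_false_eq_true] using this

theorem ncard_rowClass_eq [Finite X] (i j : {b // S b} → Fin n) :
    (rowClass q S i).ncard = (rowClass q S j).ncard :=
  le_antisymm (ncard_rowClass_le i j) (ncard_rowClass_le j i)

/-- Each block in `S` has a point in the row, so the labeling determines the index. Through-blocks
meet both rows, which makes this applicable to either row. -/
theorem rowClass_index_eq (hS : ∀ b, S b → ∃ a, q a = b) (i j : {b // S b} → Fin n)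
    (t : X → Fin n) (hi : t ∈ rowClass q S i) (hj : t ∈ rowClass q S j) : i = j := by
  funext b
  obtain ⟨a, ha⟩ := hS b.1 b.2
  rw [← hi.2 a b ha, hj.2 a b ha]

theorem exists_mem_rowClass (hS : ∀ b, S b → ∃ a, q a = b) {t : X → Fin n}
    (ht : ∀ a b, q a = q b → t a = t b) : ∃ i, t ∈ rowClass q S i := by
  choose f hf using hS
  exact ⟨fun b => t (f b.1 b.2), ht, fun a b h => ht _ _ (h.trans (hf b.1 b.2).symm)⟩

end RowClass

namespace TwoColouredPartition

/-! ### The classes of labelings of a partition -/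

variable (p : TwoColouredPartition) {N d : ℕ}

instance : Finite p.ThroughBlock :=
  inferInstanceAs (Finite {b : Quotient p.blocks //
    (∃ a : Fin p.k, Quotient.mk p.blocks (Sum.inl a) = b) ∧
      ∃ a : Fin p.l, Quotient.mk p.blocks (Sum.inr a) = b})

/-- The block of the quotient contains both upper and lower points. -/
def IsThrough (b : Quotient p.blocks) : Prop :=
  (∃ a : Fin p.k, Quotient.mk p.blocks (Sum.inl a) = b) ∧
    ∃ a : Fin p.l, Quotient.mk p.blocks (Sum.inr a) = b

theorem upperClass_eq_rowClass (i : p.ThroughBlock → Fin N) :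
    p.upperClass i = rowClass (fun a => Quotient.mk p.blocks (Sum.inl a)) p.IsThrough i :=
  Set.ext fun _ => and_congr_left' (forall₂_congr fun _ _ => imp_congr_left Quotient.eq.symm)

theorem lowerClass_eq_rowClass (i : p.ThroughBlock → Fin N) :
    p.lowerClass i = rowClass (fun a => Quotient.mk p.blocks (Sum.inr a)) p.IsThrough i :=
  Set.ext fun _ => and_congr_left' (forall₂_congr fun _ _ => imp_congr_left Quotient.eq.symm)

theorem disjointClasses_upperClass : DisjointClasses (p.upperClass (N := N)) := by
  intro i j t hi hj
  rw [upperClass_eq_rowClass] at hi hj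
  exact rowClass_index_eq (fun b hb => hb.1) i j t hi hj

theorem disjointClasses_lowerClass : DisjointClasses (p.lowerClass (N := N)) := by
  intro i j t hi hj
  rw [lowerClass_eq_rowClass] at hi hj
  exact rowClass_index_eq (fun b hb => hb.2) i j t hi hj

theorem upperClass_nonempty (hN : 0 < N) (i : p.ThroughBlock → Fin N) :
    (p.upperClass i).Nonempty := by
  rw [upperClass_eq_rowClass]
  exact rowClass_nonempty hN i

theorem lowerClass_nonempty (hN : 0 < N) (i : p.ThroughBlock → Fin N) :
    (p.lowerClass i).Nonempty := by
  rw [lowerClass_eq_rowClass]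
  exact rowClass_nonempty hN i

theorem ncard_lowerClass_eq (i j : p.ThroughBlock → Fin N) :
    (p.lowerClass i).ncard = (p.lowerClass j).ncard := by
  rw [lowerClass_eq_rowClass, lowerClass_eq_rowClass]
  exact ncard_rowClass_eq i j

/-- Every valid labeling belongs to the class given by its own values on the through-blocks. Thus
`T_0` is the complement of the union of the classes, as the abstract class sums require. -/
theorem mem_upperInvalid_iff (t : Fin p.k → Fin N) :
    t ∈ p.upperInvalid N ↔ ∀ i, t ∉ p.upperClass i := by
  refine ⟨fun h i hi => h hi.1, fun h hv => ?_⟩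
  obtain ⟨i, hi⟩ := exists_mem_rowClass (q := fun a => Quotient.mk p.blocks (Sum.inl a))
    (S := p.IsThrough) (fun b hb => hb.1) (t := t) fun a b hab => hv a b (Quotient.eq.1 hab)
  exact h i ((p.upperClass_eq_rowClass i).symm ▸ hi)

theorem mem_lowerInvalid_iff (t : Fin p.l → Fin N) :
    t ∈ p.lowerInvalid N ↔ ∀ i, t ∉ p.lowerClass i := by
  refine ⟨fun h i hi => h hi.1, fun h hv => ?_⟩
  obtain ⟨i, hi⟩ := exists_mem_rowClass (q := fun a => Quotient.mk p.blocks (Sum.inr a))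
    (S := p.IsThrough) (fun b hb => hb.2) (t := t) fun a b hab => hv a b (Quotient.eq.1 hab)
  exact h i ((p.lowerClass_eq_rowClass i).symm ▸ hi)

variable {A : Type*} [Ring A] [StarRing A]

/-! ### The relations as properties of matrices -/

/-- The matrix `u` satisfies the relations `R^{Gr}_p(u)`. -/
def SatisfiesGroup (u : Matrix (Fin N) (Fin N) A) : Prop :=
  IsIntertwining p.upperColour p.upperClass p.lowerColour p.lowerClass u

theorem satisfiesGroup_iff (u : Matrix (Fin N) (Fin N) A) :
    p.SatisfiesGroup u ↔ ∀ r ∈ p.groupRelations u, r = 0 := by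
  constructor
  · rintro h r ((⟨i, j, γ, hγ, γ', hγ', rfl⟩ | ⟨i, γ, hγ, rfl⟩) | ⟨j, γ', hγ', rfl⟩)
    · exact sub_eq_zero.2 (h.eq i j γ hγ γ' hγ')
    · exact h.upper i γ ((p.mem_upperInvalid_iff γ).1 hγ)
    · exact h.lower j γ' ((p.mem_lowerInvalid_iff γ').1 hγ')
  · intro h
    refine ⟨fun i j γ hγ γ' hγ' => sub_eq_zero.1 (h _ (Or.inl (Or.inl ⟨i, j, γ, hγ, γ', hγ', rfl⟩))),
      fun i γ hγ => h _ (Or.inl (Or.inr ⟨i, γ, (p.mem_upperInvalid_iff γ).2 hγ, rfl⟩)),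
      fun j γ' hγ' => h _ (Or.inr ⟨j, γ', (p.mem_lowerInvalid_iff γ').2 hγ', rfl⟩)⟩

/-- The matrix `x` satisfies the relations `R^{Sp}_p(x)`. -/
structure SatisfiesSpace (hd : d ≤ N) (x : Matrix (Fin N) (Fin d) A) : Prop where
  eq : ∀ i j γ γ', Fin.castLE hd ∘ γ ∈ p.upperClass j → Fin.castLE hd ∘ γ' ∈ p.lowerClass j →
    p.upperSum x i γ = p.lowerSum x i γ'
  upper : ∀ i γ, Fin.castLE hd ∘ γ ∈ p.upperInvalid N → p.upperSum x i γ = 0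
  lower : ∀ i γ', Fin.castLE hd ∘ γ' ∈ p.lowerInvalid N → p.lowerSum x i γ' = 0

theorem satisfiesSpace_iff (hd : d ≤ N) (x : Matrix (Fin N) (Fin d) A) :
    p.SatisfiesSpace hd x ↔ ∀ r ∈ p.spaceRelations hd x, r = 0 := by
  constructor
  · rintro h r ((⟨i, j, γ, γ', hγ, hγ', rfl⟩ | ⟨i, γ, hγ, rfl⟩) | ⟨i, γ', hγ', rfl⟩)
    · exact sub_eq_zero.2 (h.eq i j γ γ' hγ hγ')
    · exact h.upper i γ hγ
    · exact h.lower i γ' hγ'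
  · intro h
    exact ⟨fun i j γ γ' hγ hγ' =>
        sub_eq_zero.1 (h _ (Or.inl (Or.inl ⟨i, j, γ, γ', hγ, hγ', rfl⟩))),
      fun i γ hγ => h _ (Or.inl (Or.inr ⟨i, γ, hγ, rfl⟩)),
      fun i γ' hγ' => h _ (Or.inr ⟨i, γ', hγ', rfl⟩)⟩

section Map

variable {B : Type*} [Ring B] [StarRing B] [Algebra ℂ A] [Algebra ℂ B]
  (φ : A →⋆ₐ[ℂ] B)

theorem map_upperSum (x : Matrix (Fin N) (Fin d) A) (i : p.ThroughBlock → Fin N)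
    (γ : Fin p.k → Fin d) : φ (p.upperSum x i γ) = p.upperSum (x.map φ) i γ :=
  map_classSum φ _ _ x i γ

theorem map_lowerSum (x : Matrix (Fin N) (Fin d) A) (i : p.ThroughBlock → Fin N)
    (γ : Fin p.l → Fin d) : φ (p.lowerSum x i γ) = p.lowerSum (x.map φ) i γ :=
  map_classSum φ _ _ x i γ

/-- Used for two homomorphisms on the free *-algebra: the canonical map shows that the generators
satisfy the relations, and evaluation shows that a matrix satisfying them induces a homomorphism. -/
theorem image_groupRelations (u : Matrix (Fin N) (Fin N) A) :
    φ '' p.groupRelations u = p.groupRelations (u.map φ) := by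
  apply Set.Subset.antisymm
  · rintro _ ⟨r, (⟨i, j, γ, hγ, γ', hγ', rfl⟩ | ⟨i, γ, hγ, rfl⟩) | ⟨j, γ', hγ', rfl⟩, rfl⟩
    · exact Or.inl (Or.inl ⟨i, j, γ, hγ, γ', hγ', by
        rw [map_sub, map_upperSum, map_lowerSum, Matrix.transpose_map]⟩)
    · exact Or.inl (Or.inr ⟨i, γ, hγ, p.map_upperSum φ u i γ⟩)
    · exact Or.inr ⟨j, γ', hγ', p.map_lowerSum φ u.transpose j γ'⟩
  · rintro _ ((⟨i, j, γ, hγ, γ', hγ', rfl⟩ | ⟨i, γ, hγ, rfl⟩) | ⟨j, γ', hγ', rfl⟩)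
    · exact ⟨_, Or.inl (Or.inl ⟨i, j, γ, hγ, γ', hγ', rfl⟩), by
        rw [map_sub, map_upperSum, map_lowerSum, Matrix.transpose_map]⟩
    · exact ⟨_, Or.inl (Or.inr ⟨i, γ, hγ, rfl⟩), p.map_upperSum φ u i γ⟩
    · exact ⟨_, Or.inr ⟨j, γ', hγ', rfl⟩, p.map_lowerSum φ u.transpose j γ'⟩

theorem image_spaceRelations (hd : d ≤ N) (x : Matrix (Fin N) (Fin d) A) :
    φ '' p.spaceRelations hd x = p.spaceRelations hd (x.map φ) := by
  apply Set.Subset.antisymm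
  · rintro _ ⟨r, (⟨i, j, γ, γ', hγ, hγ', rfl⟩ | ⟨i, γ, hγ, rfl⟩) | ⟨i, γ', hγ', rfl⟩, rfl⟩
    · exact Or.inl (Or.inl ⟨i, j, γ, γ', hγ, hγ', by rw [map_sub, map_upperSum, map_lowerSum]⟩)
    · exact Or.inl (Or.inr ⟨i, γ, hγ, p.map_upperSum φ x i γ⟩)
    · exact Or.inr ⟨i, γ', hγ', p.map_lowerSum φ x i γ'⟩
  · rintro _ ((⟨i, j, γ, γ', hγ, hγ', rfl⟩ | ⟨i, γ, hγ, rfl⟩) | ⟨i, γ', hγ', rfl⟩)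
    · exact ⟨_, Or.inl (Or.inl ⟨i, j, γ, γ', hγ, hγ', rfl⟩), by
        rw [map_sub, map_upperSum, map_lowerSum]⟩
    · exact ⟨_, Or.inl (Or.inr ⟨i, γ, hγ, rfl⟩), p.map_upperSum φ x i γ⟩
    · exact ⟨_, Or.inr ⟨i, γ', hγ', rfl⟩, p.map_lowerSum φ x i γ'⟩

theorem SatisfiesSpace.map {p : TwoColouredPartition} {hd : d ≤ N} {x : Matrix (Fin N) (Fin d) A}
    (h : p.SatisfiesSpace hd x) : p.SatisfiesSpace hd (x.map φ) where
  eq i j γ γ' hγ hγ' := by rw [← map_upperSum, ← map_lowerSum, h.eq i j γ γ' hγ hγ']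
  upper i γ hγ := by rw [← map_upperSum, h.upper i γ hγ, map_zero]
  lower i γ hγ := by rw [← map_lowerSum, h.lower i γ hγ, map_zero]

end Map

/-! ### The mixed-coloured pair partitions -/

theorem sum_pair (c₁ c₂ : Colour) (x : Matrix (Fin N) (Fin d) A) (s : Set (Fin 2 → Fin N))
    (hs : ∀ t, t ∈ s ↔ t 0 = t 1) [DecidablePred (· ∈ s)] (γ : Fin 2 → Fin d) :
    ∑ t : Fin 2 → Fin N with t ∈ s, matrixWord ![c₁, c₂] x t γ =
      ∑ v, c₁.pow (x v (γ 0)) * c₂.pow (x v (γ 1)) := by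
  symm
  refine Finset.sum_bij (fun v _ => fun _ => v) (fun v _ => ?_) (fun v _ v' _ h => congrFun h 0)
    (fun t ht => ?_) (fun v _ => ?_)
  · exact Finset.mem_filter.2 ⟨Finset.mem_univ _, (hs _).2 rfl⟩
  · have h := (hs t).1 (Finset.mem_filter.1 ht).2
    exact ⟨t 0, Finset.mem_univ _, funext fun a => by fin_cases a <;> simp [h]⟩
  · simp [matrixWord, List.ofFn_succ]

instance (c₁ c₂ : Colour) : IsEmpty (upperPair c₁ c₂).ThroughBlock :=
  ⟨fun b => Fin.elim0 b.2.2.choose⟩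

theorem mem_lowerClass_lowerPair {c₁ c₂ : Colour} (i : (lowerPair c₁ c₂).ThroughBlock → Fin N)
    (t : Fin 2 → Fin N) : t ∈ (lowerPair c₁ c₂).lowerClass i ↔ t 0 = t 1 := by
  refine ⟨fun h => h.1 (0 : Fin 2) (1 : Fin 2) trivial, fun h =>
    ⟨fun (a : Fin 2) (b : Fin 2) _ => ?_, fun _ b => isEmptyElim b⟩⟩
  fin_cases a <;> fin_cases b <;> simp [h]

theorem mem_upperClass_upperPair {c₁ c₂ : Colour} (i : (upperPair c₁ c₂).ThroughBlock → Fin N)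
    (t : Fin 2 → Fin N) : t ∈ (upperPair c₁ c₂).upperClass i ↔ t 0 = t 1 := by
  refine ⟨fun h => h.1 (0 : Fin 2) (1 : Fin 2) trivial, fun h =>
    ⟨fun (a : Fin 2) (b : Fin 2) _ => ?_, fun _ b => isEmptyElim b⟩⟩
  fin_cases a <;> fin_cases b <;> simp [h]

theorem mem_lowerClass_upperPair {c₁ c₂ : Colour} (i : (upperPair c₁ c₂).ThroughBlock → Fin N)
    (t : Fin (upperPair c₁ c₂).l → Fin N) : t ∈ (upperPair c₁ c₂).lowerClass i :=
  ⟨fun a => Fin.elim0 a, fun a => Fin.elim0 a⟩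

theorem lowerSum_upperPair {c₁ c₂ : Colour} (x : Matrix (Fin N) (Fin d) A)
    (i : (upperPair c₁ c₂).ThroughBlock → Fin N) (γ : Fin (upperPair c₁ c₂).l → Fin d) :
    (upperPair c₁ c₂).lowerSum x i γ = 1 := by
  classical
  unfold lowerSum
  refine (Finset.sum_eq_single (fun a => Fin.elim0 a) (fun t _ ht => ?_) fun h => ?_).trans ?_
  · exact absurd (funext fun a => Fin.elim0 a) ht
  · exact absurd (Finset.mem_filter.2 ⟨Finset.mem_univ _, mem_lowerClass_upperPair i _⟩) h
  · rfl

theorem SatisfiesGroup.lowerPair_sum {c₁ c₂ : Colour} {u : Matrix (Fin N) (Fin N) A}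
    (h : (lowerPair c₁ c₂).SatisfiesGroup u) (i j : Fin N) :
    ∑ s, c₁.pow (u i s) * c₂.pow (u j s) = if i = j then 1 else 0 := by
  classical
  -- There are no through-blocks, so the empty labeling `isEmptyElim` is the only index. The
  -- labeling `![i, j]` is valid exactly when `i = j`; then the empty upper row contributes `1`, and
  -- otherwise the sum vanishes by the third kind of relation.
  have hsum : (lowerPair c₁ c₂).lowerSum u.transpose isEmptyElim ![i, j] =
      ∑ s, c₁.pow (u i s) * c₂.pow (u j s) :=
    sum_pair c₁ c₂ u.transpose _ (mem_lowerClass_lowerPair isEmptyElim) ![i, j]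
  rw [← hsum]
  split_ifs with hij
  · rw [← upperSum_lowerPair u isEmptyElim fun a => Fin.elim0 a]
    exact (h.eq _ _ _ (mem_upperClass_lowerPair _ _) ![i, j]
      ((mem_lowerClass_lowerPair _ _).2 hij)).symm
  · exact h.lower _ ![i, j] fun i' hi' => hij ((mem_lowerClass_lowerPair _ _).1 hi')

theorem SatisfiesGroup.upperPair_sum {c₁ c₂ : Colour} {u : Matrix (Fin N) (Fin N) A}
    (h : (upperPair c₁ c₂).SatisfiesGroup u) (i j : Fin N) :
    ∑ s, c₁.pow (u s i) * c₂.pow (u s j) = if i = j then 1 else 0 := by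
  classical
  have hsum : (upperPair c₁ c₂).upperSum u isEmptyElim ![i, j] =
      ∑ s, c₁.pow (u s i) * c₂.pow (u s j) :=
    sum_pair c₁ c₂ u _ (mem_upperClass_upperPair isEmptyElim) ![i, j]
  rw [← hsum]
  split_ifs with hij
  · rw [← lowerSum_upperPair u.transpose isEmptyElim fun a => Fin.elim0 a]
    exact h.eq _ _ ![i, j] ((mem_upperClass_upperPair _ _).2 hij) _ (mem_lowerClass_upperPair _ _)
  · exact h.upper _ ![i, j] fun i' hi' => hij ((mem_upperClass_upperPair _ _).1 hi')

/-- Each of the four pairs gives one of the four unitarity identities: the upper pairs those summed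
over row indices, the lower pairs those summed over column indices. -/
theorem isBiunitary_of_mixedPairs {u : Matrix (Fin N) (Fin N) A}
    (h : ∀ p ∈ mixedPairs, p.SatisfiesGroup u) : IsBiunitary u where
  sum_star_mul c i j := by
    cases c
    · exact (h (upperPair .black .white) (by simp [mixedPairs])).upperPair_sum i j
    · simpa [Colour.pow] using
        (h (upperPair .white .black) (by simp [mixedPairs])).upperPair_sum i j
  sum_mul_star c i j := by
    cases c
    · exact (h (lowerPair .white .black) (by simp [mixedPairs])).lowerPair_sum i j
    · simpa [Colour.pow] using
        (h (lowerPair .black .white) (by simp [mixedPairs])).lowerPair_sum i j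

/-! ### Products of matrices with commuting entries -/

/-- All class sums of `u` and of its transpose are given by the constants `c`. -/
structure IsConstant (u : Matrix (Fin N) (Fin N) A)
    (c : (p.ThroughBlock → Fin N) → (p.ThroughBlock → Fin N) → A) : Prop where
  upper : IsClassConstant p.upperColour p.upperClass u c
  lower : IsClassConstant p.lowerColour p.lowerClass u c
  upper_transpose : IsClassConstant p.upperColour p.upperClass u.transpose fun i j => c j i
  lower_transpose : IsClassConstant p.lowerColour p.lowerClass u.transpose fun i j => c j i

variable {p}

theorem SatisfiesGroup.exists_isConstant [Algebra ℂ A] {u : Matrix (Fin N) (Fin N) A}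
    (h : p.SatisfiesGroup u) (hN : 0 < N) (hu : IsBiunitary u) : ∃ c, p.IsConstant u c := by
  obtain ⟨c, h1, h2, h3, h4⟩ := IsIntertwining.exists_common_const h hu
    p.disjointClasses_upperClass p.disjointClasses_lowerClass (p.upperClass_nonempty hN)
    (p.lowerClass_nonempty hN) p.ncard_lowerClass_eq
  exact ⟨c, h1, h2, h3, h4⟩

/-- This symmetry reduces the right action to the left one. -/
theorem IsConstant.transpose {u : Matrix (Fin N) (Fin N) A}
    {c : (p.ThroughBlock → Fin N) → (p.ThroughBlock → Fin N) → A} (h : p.IsConstant u c) :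
    p.IsConstant u.transpose fun i j => c j i :=
  ⟨h.upper_transpose, h.lower_transpose, h.upper, h.lower⟩

theorem IsConstant.map {B : Type*} [Ring B] [StarRing B] [Algebra ℂ A] [Algebra ℂ B]
    {u : Matrix (Fin N) (Fin N) A} {c : (p.ThroughBlock → Fin N) → (p.ThroughBlock → Fin N) → A}
    (h : p.IsConstant u c) (φ : A →⋆ₐ[ℂ] B) :
    p.IsConstant (u.map φ) fun i j => φ (c i j) :=
  ⟨h.upper.map φ, h.lower.map φ, h.upper_transpose.map φ, h.lower_transpose.map φ⟩

/-- Upper and lower class sums of `a * b` are the same combinations, with coefficients `c i m`, of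
those of `b`. This is where the two rows of `a` must share their constants. -/
theorem SatisfiesSpace.mul {hd : d ≤ N} {a : Matrix (Fin N) (Fin N) A}
    {b : Matrix (Fin N) (Fin d) A} {c : (p.ThroughBlock → Fin N) → (p.ThroughBlock → Fin N) → A}
    (hb : p.SatisfiesSpace hd b) (ha : p.IsConstant a c)
    (h : ∀ (c : Colour) i j k l, Commute (a i j) (c.pow (b k l))) :
    p.SatisfiesSpace hd (a * b) := by
  classical
  have := Fintype.ofFinite p.ThroughBlock
  have hU := fun i γ => ha.upper.classSum_mul p.disjointClasses_upperClass h i γ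
  have hL := fun i γ => ha.lower.classSum_mul p.disjointClasses_lowerClass h i γ
  refine ⟨fun i j γ γ' hγ hγ' => ?_, fun i γ hγ => ?_, fun i γ' hγ' => ?_⟩
  · refine (hU i γ).trans (Eq.trans ?_ (hL i γ').symm)
    exact Finset.sum_congr rfl fun m _ => congrArg _ (hb.eq m j γ γ' hγ hγ')
  · refine (hU i γ).trans (Finset.sum_eq_zero fun m _ => ?_)
    exact (congrArg _ (hb.upper m γ hγ)).trans (mul_zero _)
  · refine (hL i γ').trans (Finset.sum_eq_zero fun m _ => ?_)
    exact (congrArg _ (hb.lower m γ' hγ')).trans (mul_zero _)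

/-- Upper sums of the product are `∑_m c i m * c' m j`, while transposed lower sums give the same
products with the factors exchanged. Only the upper constants and the transposed lower constants of
the factors enter. -/
theorem IsConstant.satisfiesGroup_mul {a b : Matrix (Fin N) (Fin N) A}
    {c c' : (p.ThroughBlock → Fin N) → (p.ThroughBlock → Fin N) → A}
    (ha : p.IsConstant a c) (hb : p.IsConstant b c')
    (h : ∀ (c : Colour) i j k l, Commute (a i j) (c.pow (b k l)))
    (hc : ∀ i j k l, Commute (c i j) (c' k l)) : p.SatisfiesGroup (a * b) := by
  classical
  have := Fintype.ofFinite p.ThroughBlock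
  -- Over a noncommutative ring this needs the entries of `a` and `b` to commute.
  have hT : (a * b).transpose = b.transpose * a.transpose := by
    ext i j
    simp only [Matrix.transpose_apply, Matrix.mul_apply]
    exact Finset.sum_congr rfl fun s _ => (h .white j s s i).eq
  have hU := fun i γ => ha.upper.classSum_mul p.disjointClasses_upperClass h i γ
  have hL := fun i γ => hb.lower_transpose.classSum_mul p.disjointClasses_lowerClass
    (b := a.transpose) (fun e i j k l =>
      (Colour.commute_pow_of (fun e => h e l k j i) e .white).symm) i γ
  rw [← hT] at hL
  refine ⟨fun i j γ hγ γ' hγ' => ?_, fun i γ hγ => ?_, fun j γ' hγ' => ?_⟩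
  · rw [hU, hL]
    refine Finset.sum_congr rfl fun m _ => ?_
    rw [hb.upper.eq_of_mem m j γ hγ, ha.lower_transpose.eq_of_mem m i γ' hγ']
    exact (hc i m m j).eq
  · rw [hU]
    exact Finset.sum_eq_zero fun m _ => by rw [hb.upper.eq_zero m γ hγ, mul_zero]
  · rw [hL]
    exact Finset.sum_eq_zero fun m _ => by rw [ha.lower_transpose.eq_zero m γ' hγ', mul_zero]

end TwoColouredPartition

/-! ### The easy quantum group and the partition quantum space -/

open TwoColouredPartition

section Universal

variable {N d : ℕ} {P : Set TwoColouredPartition} (hP : mixedPairs ⊆ P)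

theorem EasyQuantumGroup.u_eq_map : EasyQuantumGroup.u N P hP =
    (freeMatrix N N).map (UniversalCStarAlgebra.ofFree (easyRelations N P)
      (universalExists_easyRelations N hP)) := rfl

theorem PartitionQuantumSpace.x_eq_map (hd : d ≤ N) : PartitionQuantumSpace.x hd P hP =
    (freeMatrix N d).map (UniversalCStarAlgebra.ofFree (pqsRelations hd P)
      (universalExists_pqsRelations hd hP)) := rfl

theorem EasyQuantumGroup.satisfiesGroup_u {p : TwoColouredPartition} (hp : p ∈ P) :
    p.SatisfiesGroup (EasyQuantumGroup.u N P hP) := by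
  rw [satisfiesGroup_iff, u_eq_map, ← image_groupRelations]
  rintro _ ⟨r, hr, rfl⟩
  exact UniversalCStarAlgebra.ofFree_eq_zero _ _ (Set.mem_biUnion hp hr)

theorem PartitionQuantumSpace.satisfiesSpace_x (hd : d ≤ N) {p : TwoColouredPartition}
    (hp : p ∈ P) : p.SatisfiesSpace hd (PartitionQuantumSpace.x hd P hP) := by
  rw [satisfiesSpace_iff, x_eq_map, ← image_spaceRelations]
  rintro _ ⟨r, hr, rfl⟩
  exact UniversalCStarAlgebra.ofFree_eq_zero _ _ (Set.mem_biUnion hp hr)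

theorem EasyQuantumGroup.isBiunitary_u : IsBiunitary (EasyQuantumGroup.u N P hP) :=
  isBiunitary_of_mixedPairs fun _ hp => satisfiesGroup_u hP (hP hp)

theorem EasyQuantumGroup.generates_u : GeneratesCStar (EasyQuantumGroup.u N P hP) :=
  UniversalCStarAlgebra.topologicalClosure_adjoin_gen _ _

theorem PartitionQuantumSpace.generates_x (hd : d ≤ N) :
    GeneratesCStar (PartitionQuantumSpace.x hd P hP) :=
  UniversalCStarAlgebra.topologicalClosure_adjoin_gen _ _

theorem map_freeMatrix_eval {m n : ℕ} {D : Type*} [Ring D] [StarRing D] [Algebra ℂ D]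
    [StarModule ℂ D] (y : Matrix (Fin m) (Fin n) D) :
    (freeMatrix m n).map (FreeStarAlgebra.eval fun e : Fin m × Fin n => y e.1 e.2) = y :=
  Matrix.ext fun i j =>
    FreeStarAlgebra.eval_gen (fun e : Fin m × Fin n => y e.1 e.2) (i, j)

theorem EasyQuantumGroup.exists_hom {D : Type*} [CStarAlgebra D] (v : Matrix (Fin N) (Fin N) D)
    (hv : ∀ p ∈ P, p.SatisfiesGroup v) :
    ∃ φ : EasyQuantumGroup N P hP →⋆ₐ[ℂ] D, ∀ i j, φ (EasyQuantumGroup.u N P hP i j) = v i j := by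
  obtain ⟨φ, hφ⟩ := UniversalCStarAlgebra.exists_lift (easyRelations N P)
    (universalExists_easyRelations N hP) (fun e => v e.1 e.2) fun r hr => by
      obtain ⟨p, hp, hr⟩ := Set.mem_iUnion₂.1 hr
      refine (p.satisfiesGroup_iff v).1 (hv p hp) _ ?_
      have h := p.image_groupRelations (FreeStarAlgebra.eval fun e : Fin N × Fin N => v e.1 e.2)
        (freeMatrix N N)
      rw [map_freeMatrix_eval] at h
      exact h ▸ ⟨r, hr, rfl⟩
  exact ⟨φ, fun i j => hφ (i, j)⟩

theorem PartitionQuantumSpace.existsUnique_hom (hd : d ≤ N) {D : Type*} [CStarAlgebra D]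
    (y : Matrix (Fin N) (Fin d) D) (hy : ∀ p ∈ P, p.SatisfiesSpace hd y) :
    ∃! φ : PartitionQuantumSpace hd P hP →⋆ₐ[ℂ] D,
      ∀ i j, φ (PartitionQuantumSpace.x hd P hP i j) = y i j := by
  obtain ⟨φ, hφ⟩ := UniversalCStarAlgebra.exists_lift (pqsRelations hd P)
    (universalExists_pqsRelations hd hP) (fun e => y e.1 e.2) fun r hr => by
      obtain ⟨p, hp, hr⟩ := Set.mem_iUnion₂.1 hr
      refine (p.satisfiesSpace_iff hd y).1 (hy p hp) _ ?_
      have h := p.image_spaceRelations (FreeStarAlgebra.eval fun e : Fin N × Fin d => y e.1 e.2)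
        hd (freeMatrix N d)
      rw [map_freeMatrix_eval] at h
      exact h ▸ ⟨r, hr, rfl⟩
  refine ⟨φ, fun i j => hφ (i, j), fun ψ hψ => ?_⟩
  exact UniversalCStarAlgebra.hom_ext _ _ fun e => (hψ e.1 e.2).trans (hφ e).symm

end Universal

/-! ### Invertibility, comultiplication and actions -/

theorem IsBiunitary.isUnit {n : ℕ} {A : Type*} [Ring A] [StarRing A]
    {u : Matrix (Fin n) (Fin n) A} (hu : IsBiunitary u) : IsUnit u :=
  ⟨⟨u, u.conjTranspose,
    Matrix.ext fun i j => by
      rw [Matrix.mul_apply, Matrix.one_apply]; exact hu.sum_mul_star .white i j,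
    Matrix.ext fun i j => by
      rw [Matrix.mul_apply, Matrix.one_apply]; exact hu.sum_star_mul .white i j⟩, rfl⟩

/-- Taking entrywise adjoints exchanges the two colours, and biunitarity covers both of them. -/
theorem IsBiunitary.map_star {n : ℕ} {A : Type*} [Ring A] [StarRing A]
    {u : Matrix (Fin n) (Fin n) A} (hu : IsBiunitary u) : IsBiunitary (u.map star) where
  sum_star_mul c i j := by
    cases c
    · exact hu.sum_star_mul .black i j
    · simpa [Colour.pow] using hu.sum_star_mul .white i j
  sum_mul_star c i j := by
    cases c
    · exact hu.sum_mul_star .black i j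
    · simpa [Colour.pow] using hu.sum_mul_star .white i j

theorem MinTensor.commute_pow {A B : Type*} [CStarAlgebra A] [CStarAlgebra B] (a : A) (b : B)
    (c : Colour) : Commute (inLeft A B a) (c.pow (inRight A B b)) := by
  rw [← Colour.map_pow]
  exact commute_inLeft_inRight a _

theorem EasyQuantumGroup.isCompactMatrixQuantumGroup {N : ℕ} (hN : 0 < N)
    {P : Set TwoColouredPartition} (hP : mixedPairs ⊆ P) :
    IsCompactMatrixQuantumGroup (EasyQuantumGroup.u N P hP) where
  generates := generates_u hP
  isUnit := (isBiunitary_u hP).isUnit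
  isUnit_conj := (isBiunitary_u hP).map_star.isUnit
  exists_comul := by
    let u := EasyQuantumGroup.u N P hP
    let A := EasyQuantumGroup N P hP
    obtain ⟨Δ, hΔ⟩ := exists_hom hP
      (u.map (MinTensor.inLeft A A) * u.map (MinTensor.inRight A A)) fun p hp => by
        obtain ⟨c, hc⟩ := (satisfiesGroup_u hP hp).exists_isConstant hN (isBiunitary_u hP)
        exact (hc.map (MinTensor.inLeft A A)).satisfiesGroup_mul (hc.map (MinTensor.inRight A A))
          (fun _ _ _ _ _ => MinTensor.commute_pow _ _ _)
          fun _ _ _ _ => MinTensor.commute_inLeft_inRight _ _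
    refine ⟨Δ, fun i j => (hΔ i j).trans ?_⟩
    rw [Matrix.mul_apply]
    exact Finset.sum_congr rfl fun k _ => MinTensor.inLeft_mul_inRight _ _

/-- The matrix `v` acts on the partition quantum space if the class sums of `v` and of its
transpose are given by common constants. -/
theorem PartitionQuantumSpace.existsUnique_action {N d : ℕ} (hd : d ≤ N)
    {P : Set TwoColouredPartition} (hP : mixedPairs ⊆ P) {A : Type*} [CStarAlgebra A]
    (v : Matrix (Fin N) (Fin N) A) (hv : ∀ p ∈ P, ∃ c, p.IsConstant v c) :
    ∃! α : PartitionQuantumSpace hd P hP →⋆ₐ[ℂ] MinTensor A (PartitionQuantumSpace hd P hP),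
      ∀ i j, α (x hd P hP i j) = ∑ k, MinTensor.tmul (v i k) (x hd P hP k j) := by
  have h := existsUnique_hom hP hd
    (v.map (MinTensor.inLeft A (PartitionQuantumSpace hd P hP)) *
      (x hd P hP).map (MinTensor.inRight A (PartitionQuantumSpace hd P hP))) fun p hp => by
      obtain ⟨c, hc⟩ := hv p hp
      exact ((satisfiesSpace_x hP hd hp).map _).mul (hc.map _)
        fun _ _ _ _ _ => MinTensor.commute_pow _ _ _
  simpa only [Matrix.mul_apply, Matrix.map_apply, MinTensor.inLeft_mul_inRight] using h

end

theorem mainTheorem2 (N d : ℕ) (hd1 : 1 ≤ d) (hd : d ≤ N) (P : Set TwoColouredPartition)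
    (hP : TwoColouredPartition.mixedPairs ⊆ P) :
    IsCompactMatrixQuantumGroup (EasyQuantumGroup.u N P hP) ∧
    GeneratesCStar (PartitionQuantumSpace.x hd P hP) ∧
    (∃! α : PartitionQuantumSpace hd P hP →⋆ₐ[ℂ]
        MinTensor (EasyQuantumGroup N P hP) (PartitionQuantumSpace hd P hP),
      IsLeftMatrixVectorAction (EasyQuantumGroup.u N P hP) (PartitionQuantumSpace.x hd P hP) α) ∧
    (∃! β : PartitionQuantumSpace hd P hP →⋆ₐ[ℂ]
        MinTensor (EasyQuantumGroup N P hP) (PartitionQuantumSpace hd P hP),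
      IsRightMatrixVectorAction (EasyQuantumGroup.u N P hP) (PartitionQuantumSpace.x hd P hP) β) := by
  have hN : 0 < N := lt_of_lt_of_le hd1 hd
  have hu : ∀ p ∈ P, ∃ c, p.IsConstant (EasyQuantumGroup.u N P hP) c := fun p hp =>
    (EasyQuantumGroup.satisfiesGroup_u hP hp).exists_isConstant hN
      (EasyQuantumGroup.isBiunitary_u hP)
  refine ⟨EasyQuantumGroup.isCompactMatrixQuantumGroup hN hP,
    PartitionQuantumSpace.generates_x hP hd,
    PartitionQuantumSpace.existsUnique_action hd hP _ hu,
    -- The right action is the left formula for the transpose of `u`, since `u_{ki}` is its entry at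
    -- `(i, k)`.
    PartitionQuantumSpace.existsUnique_action hd hP (EasyQuantumGroup.u N P hP).transpose
      fun p hp => ?_⟩
  obtain ⟨c, hc⟩ := hu p hp
  exact ⟨_, hc.transpose⟩
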